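/- **Theorem 1 (Dilated VP captures $p$ and $\sigma^2$).** Fix $p\in[0,1]$, $\sigma>0$, $\kappa>0$ (not depending on $d$) and, for each dimension $d$, a vector $r=r_d\in\mathbb R^d$ with $|r|^2=d$. Let $z\sim\mathcal N(0,\mathrm{Id}_d)$ and $a\sim p\,\mathcal N(r,\sigma^2\mathrm{Id}_d)+(1-p)\,\mathcal N(-r,\sigma^2\mathrm{Id}_d)$ be independent, and let $I_t=(1-\tau(t))z+\tau(t)a$ be the dilated variance preserving interpolant, with $$\tau(t)=\frac{2\kappa t}{\sqrt d}\ \ (0\le t\le \tfrac12),\qquad \tau(t)=\frac{\kappa}{\sqrt d}+\Big(1-\frac{\kappa}{\sqrt d}\Big)(2t-1)\ \ (\tfrac12\le t\le 1).$$ Let $b_t(x)=\mathbb E[\dot I_t\mid I_t=x]$, $t\in[0,1)$, be the (continuous in $x$) velocity field of the probability flow ODE $\dot X_t=b_t(X_t)$, where at $t=\tfrac12$ the derivative $\dot I_t$ is the right derivative. Let $X^{\Delta t}$ be its explicit Euler discretization on the uniform grid with step $\Delta t=1/N$, started from $X_0\sim\mathcal N(0,\mathrm{Id}_d)$; for $t\in[0,1]$,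 $X^{\Delta t}_t$ is the value at the last grid point $\le t$. Limits of random variables are limits in distribution, and limits of processes are limits in distribution of all finite-dimensional marginals. All limits are iterated: first $d\to\infty$, then $\Delta t\to0$. *Orthogonal component.* For all $d\ge1$, $N\ge1$ and $t\in[0,1]$, $$X_t^{\Delta t}-\frac{r\cdot X_t^{\Delta t}}{d}\,r\ \sim\ \mathcal N\big(0,(\sigma_t^{\Delta t,d})^2\,\mathrm{Id}_{d-1}\big)\quad\text{on } r^\perp,$$ with numbers $\sigma_t^{\Delta t,d}\ge0$ such that $\lim_{\Delta t\to0}\lim_{d\to\infty}\sigma_t^{\Delta t,d}=1$ for $t\in[0,\tfrac12]$, and $\lim_{\Delta t\to0}\lim_{d\to\infty}\sigma_t^{\Delta t,d}=\sqrt{(2-2t)^2+(2t-1)^2\sigma^2}$ for $t\in[\tfrac12,1]$. *First phase.* On $[0,\tfrac12]$ the limit $\mu_t=\lim_{\Delta t\to0}\lim_{d\to\infty} r\cdot X_t^{\Delta t}/\sqrt d$ exists, $\mu_0\sim\mathcal N(0,1)$, $\mu_{1/2}\sim p\,\mathcal N(\kappa,1)+(1-p)\,\mathcal N(-\kappa,1)$,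 and, if $h\in\mathbb R$ is such that $p=e^h/(e^h+e^{-h})$ (such an $h$ exists exactly when $0<p<1$), then almost surely $$\dot\mu_t=2\kappa\tanh(h+2\kappa t\mu_t),\qquad t\in[0,\tfrac12].$$ *Second phase.* Restrict to step sizes for which the phase boundary $t=\tfrac12$ is a grid point, i.e. $\Delta t=1/(2n)$. On $[\tfrac12,1]$ the limit $M_t=\lim_{\Delta t\to0}\lim_{d\to\infty} r\cdot X_t^{\Delta t}/d$ exists, almost surely fulfills $$\dot M_t=\frac{-(1-t)+\sigma^2(t-\frac12)}{(1-t)^2+\sigma^2(t-\frac12)^2}\,M_t+\frac{(1-t)\,\mathrm{sgn}(M_t)}{(1-t)^2+\sigma^2(t-\frac12)^2},\qquad t\in(\tfrac12,1),$$ and $M_1\sim p^\kappa\delta_1+(1-p^\kappa)\delta_{-1}$, where $p^\kappa\in[0,1]$ depends only on $p$ and $\kappa$ and $\lim_{\kappa\to\infty}p^\kappa=p$. In particular the number of discretization steps needed does not grow with $d$: the limit $d\to\infty$ is taken at fixed $\Delta t$. -/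

import Mathlib

open MeasureTheory ProbabilityTheory Filter Topology Set
open scoped RealInnerProductSpace

noncomputable section

/-- The ambient space `ℝ^d` with its Euclidean structure. -/
abbrev Vec (d : ℕ) : Type := EuclideanSpace ℝ (Fin d)

/-- The two-mode Gaussian mixture `p N(r, σ² Id) + (1 - p) N(-r, σ² Id)` on `ℝ^d`. -/
def gaussianMixture {d : ℕ} (p σ : ℝ) (r : Vec d) : Measure (Vec d) :=
  ENNReal.ofReal p • (stdGaussian (Vec d)).map (fun w => r + σ • w) +
    ENNReal.ofReal (1 - p) • (stdGaussian (Vec d)).map (fun w => -r + σ • w)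

/-- The two-mode Gaussian mixture `p N(m, 1) + (1 - p) N(-m, 1)` on the real line. -/
def gaussianMixtureReal (p m : ℝ) : Measure ℝ :=
  ENNReal.ofReal p • gaussianReal m 1 + ENNReal.ofReal (1 - p) • gaussianReal (-m) 1

/-- The piecewise linear time dilation `τ(t)` in dimension `d`. -/
def timeDilation (κ : ℝ) (d : ℕ) (t : ℝ) : ℝ :=
  if t ≤ 1 / 2 then 2 * κ * t / √(d : ℝ)
  else κ / √(d : ℝ) + (1 - κ / √(d : ℝ)) * (2 * t - 1)

/-- The joint law of the independent pair `(z, a)`: standard Gaussian noise, mixture data. -/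
def noiseDataLaw {d : ℕ} (p σ : ℝ) (r : Vec d) : Measure (Vec d × Vec d) :=
  (stdGaussian (Vec d)).prod (gaussianMixture p σ r)

/-- The dilated variance preserving interpolant `I_t = (1 - τ(t)) z + τ(t) a`, as a random vector
on the space of pairs `(z, a)`. -/
def interpolant (κ : ℝ) {d : ℕ} (t : ℝ) (ω : Vec d × Vec d) : Vec d :=
  (1 - timeDilation κ d t) • ω.1 + timeDilation κ d t • ω.2

/-- The time derivative of `t ↦ I_t`. It is the right derivative, which is the ordinary one except
at the kink `t = 1/2`, where a forward step enters the second phase. -/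
def interpolantDeriv (κ : ℝ) {d : ℕ} (t : ℝ) (ω : Vec d × Vec d) : Vec d :=
  derivWithin (fun s => interpolant κ s ω) (Ici t) t

/-- `b` is the velocity field `b_t(x) = E[İ_t | I_t = x]` of the probability flow ODE, for
`t ∈ [0, 1)`. Conditioning on `I_t` pins `b t` only up to null sets of the law of `I_t`; since that
law has full support, requiring `b t` to be continuous pins it at every point. -/
def IsProbabilityFlowVelocity (p σ κ : ℝ) {d : ℕ} (r : Vec d) (b : ℝ → Vec d → Vec d) : Prop :=
  ∀ t ∈ Ico (0 : ℝ) 1, Continuous (b t) ∧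
    (fun ω => b t (interpolant κ t ω)) =ᵐ[noiseDataLaw p σ r]
      (noiseDataLaw p σ r)[interpolantDeriv κ t |
        MeasurableSpace.comap (interpolant κ t) inferInstance]

/-- The explicit Euler scheme with step size `1 / N` for `Ẋ_t = b_t(X_t)`, started at `x`:
the state after `k` steps. -/
def eulerState {V : Type*} [AddCommGroup V] [Module ℝ V] (b : ℝ → V → V) (N : ℕ) (x : V) : ℕ → V
  | 0 => x
  | k + 1 => eulerState b N x k + (1 / (N : ℝ)) • b ((k : ℝ) / N) (eulerState b N x k)

/-- The discretized trajectory at time `t`: the Euler state at the last grid point `k / N ≤ t`. -/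
def discretizedFlow {V : Type*} [AddCommGroup V] [Module ℝ V] (b : ℝ → V → V) (N : ℕ) (t : ℝ)
    (x : V) : V :=
  eulerState b N x ⌊t * N⌋₊

/-- The iterated limit `lim_{N → ∞} lim_{d → ∞} u N d` exists and equals `l`. -/
def HasIteratedLimit (u : ℕ → ℕ → ℝ) (l : ℝ) : Prop :=
  ∃ v : ℕ → ℝ, (∀ᶠ N in atTop, Tendsto (u N) atTop (𝓝 (v N))) ∧ Tendsto v atTop (𝓝 l)

/-- The iterated limit in distribution `lim_{N → ∞} lim_{d → ∞} X N d` is `Z`, where the random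
vectors `X N d` are functions of a standard Gaussian vector of `ℝ^d`. The inner limits are recorded
through their laws `ρ N`. -/
def HasIteratedLimitInDistribution {F Ω : Type*} [TopologicalSpace F] [MeasurableSpace F]
    [OpensMeasurableSpace F] [MeasurableSpace Ω] (X : ℕ → (d : ℕ) → Vec d → F) (Z : Ω → F)
    (P : Measure Ω) [IsProbabilityMeasure P] : Prop :=
  ∃ ρ : ℕ → ProbabilityMeasure F,
    (∀ᶠ N in atTop, TendstoInDistribution (X N) atTop (id : F → F)
      (fun d => stdGaussian (Vec d)) (ρ N : Measure F)) ∧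
    TendstoInDistribution (fun _ => (id : F → F)) atTop Z (fun N => (ρ N : Measure F)) P

/-- For processes: iterated limit in distribution of all finite-dimensional marginals at times
in `T`. -/
def ProcessHasIteratedLimit {Ω : Type*} [MeasurableSpace Ω] (T : Set ℝ)
    (X : ℕ → (d : ℕ) → ℝ → Vec d → ℝ) (Z : ℝ → Ω → ℝ)
    (P : Measure Ω) [IsProbabilityMeasure P] : Prop :=
  ∀ (m : ℕ) (t : Fin m → ℝ), (∀ i, t i ∈ T) →
    HasIteratedLimitInDistribution (fun N d x i => X N d (t i) x) (fun ω i => Z (t i) ω) P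

end

/-!
# The dilated variance preserving interpolant captures the mode weights and the variance

*Velocity field.* Given the mode `ε r` of the data, `I_t` is Gaussian with mean `τ ε r` and
covariance `V Id`, where `V = (1 - τ)² + τ² σ²` (`modeVar`). Rotating the pair (noise, data noise)
so that one of its components is the noise of `I_t` gives the conditional drift in each mode; the
Cameron–Martin formula puts both modes on one reference measure, and Bayes' rule mixes them
(`mixture_drift_eq`). The result is the closed form `flowVelocity`: a multiple of `x` plus a
multiple of `E[ε | x] r`, with `E[ε | x] = posteriorSign p (τ ⟪r, x⟫ / V)`. As the law of `I_t`
has full support, `b_t` equals it everywhere (`IsProbabilityFlowVelocity.eq_flowVelocity`).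

*Reduction to one dimension.* Across `r` the field is linear, so the Euler scheme multiplies the
orthogonal component by a number (`eulerState_flowVelocity_orthogonal`), and orthogonal
projections of standard Gaussian vectors are standard Gaussian. Along `r` the rescaled overlap
`⟪r, X⟫ / √d` follows the Euler scheme of a scalar equation (`inner_eulerState_flowVelocity`)
started from `⟪r, X₀⟫ / √d`, which is standard Gaussian for every `d ≥ 1`. Hence everything is a
function of one standard Gaussian number `g`. Both limit processes are built on `ℝ` with its
standard Gaussian measure, and the limits in distribution follow from almost sure limits in `g`
(`hasIteratedLimitInDistribution_of_overlap`).

*Orthogonal component.* As `d → ∞` the factors tend to `1` in the first phase and to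
`1 + Δt V' / (2 V)` in the second, with `V = modeVar σ (2 t - 1)`. This is the Euler scheme of
the equation solved by `√V`, which converges by `tendsto_euler_sub`.

*First phase.* As `d → ∞` the scalar equation becomes `μ' = 2κ posteriorSign p (2κ t μ)`, with a
bounded Lipschitz field; `tendsto_euler_sub` identifies the limit `Δt → 0` with its flow. This is
the probability flow of the mixture `p N(2κt, 1) + (1 - p) N(-2κt, 1)`: the distribution function
of the mixture at time `t`, evaluated at `μ_t`, does not depend on `t`
(`IsOverlapFlow.mixturePrimitive_eq`), which gives the law of `μ_{1/2}`.

*Second phase.* At `t = 1/2` the overlap `⟪r, X⟫ / d` vanishes in the limit, and the first step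
moves it by `2 Δt posteriorSign p (κ μ_{1/2})`. After that the argument of `posteriorSign` is of
order `d`, so that `E[ε | x]` saturates at the sign of the overlap, which no longer changes. The
remaining linear equation has the solution `M_t = ±(2 t - 1)`. It is affine in `t`, so the Euler
scheme follows it exactly up to the error `O(Δt)` of the first step (`abs_signalState_sub_le`).
The sign is positive when `posteriorSign p (κ μ_{1/2}) > 0`; the probability of this event,
`modeProbability p κ`, tends to `p` as `κ → ∞` by dominated convergence.
-/

/-! ### The posterior mean of the mode -/

/-- The posterior mean `E[ε | ·]` of a random sign with prior `P(ε = 1) = p`, where `u` is half the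
log-likelihood ratio of the two signs. For `p = e^h / (e^h + e^{-h})` it is `tanh (h + u)`; this
form also covers `p = 0` and `p = 1`. -/
noncomputable def posteriorSign (p u : ℝ) : ℝ :=
  (p * Real.exp u - (1 - p) * Real.exp (-u)) / (p * Real.exp u + (1 - p) * Real.exp (-u))

section posteriorSign

variable {p : ℝ}

lemma posteriorSign_denom_pos (hp : p ∈ Icc (0 : ℝ) 1) (u : ℝ) :
    0 < p * Real.exp u + (1 - p) * Real.exp (-u) := by
  have h1 := Real.exp_pos u
  have h2 := Real.exp_pos (-u)
  rcases hp.1.eq_or_lt with h | h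
  · simpa [← h] using h2
  · have : 0 ≤ (1 - p) * Real.exp (-u) := mul_nonneg (by linarith [hp.2]) h2.le
    positivity

lemma posteriorSign_eq_tanh {h : ℝ} (hh : p = Real.exp h / (Real.exp h + Real.exp (-h)))
    (u : ℝ) : posteriorSign p u = Real.tanh (h + u) := by
  have h0 : Real.exp h + Real.exp (-h) ≠ 0 := by positivity
  have h1 : 1 - p = Real.exp (-h) / (Real.exp h + Real.exp (-h)) := by
    rw [hh]; field_simp; ring
  rw [posteriorSign, h1, hh, Real.tanh_eq_sinh_div_cosh, Real.sinh_eq, Real.cosh_eq, neg_add,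
    Real.exp_add, Real.exp_add]
  field_simp

lemma abs_posteriorSign_le (hp : p ∈ Icc (0 : ℝ) 1) (u : ℝ) : |posteriorSign p u| ≤ 1 := by
  have hD := posteriorSign_denom_pos hp u
  have h1 : 0 ≤ p * Real.exp u := mul_nonneg hp.1 (Real.exp_pos _).le
  have h2 : 0 ≤ (1 - p) * Real.exp (-u) := mul_nonneg (by linarith [hp.2]) (Real.exp_pos _).le
  rw [posteriorSign, abs_div, abs_of_pos hD, div_le_one hD, abs_le]
  constructor <;> linarith

lemma hasDerivAt_posteriorSign (hp : p ∈ Icc (0 : ℝ) 1) (u : ℝ) :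
    HasDerivAt (posteriorSign p) (1 - posteriorSign p u ^ 2) u := by
  have hD := (posteriorSign_denom_pos hp u).ne'
  have he : HasDerivAt (fun u => Real.exp (-u)) (-Real.exp (-u)) u := by
    simpa using (hasDerivAt_neg u).exp
  have hn := ((Real.hasDerivAt_exp u).const_mul p).sub (he.const_mul (1 - p))
  have hd := ((Real.hasDerivAt_exp u).const_mul p).add (he.const_mul (1 - p))
  refine (hn.div hd hD).congr_deriv ?_
  simp only [posteriorSign, Pi.add_apply, Pi.sub_apply] at hD ⊢
  field_simp
  ring

lemma continuous_posteriorSign (hp : p ∈ Icc (0 : ℝ) 1) : Continuous (posteriorSign p) :=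
  continuous_iff_continuousAt.2 fun u => (hasDerivAt_posteriorSign hp u).continuousAt

lemma posteriorSign_sq_le (hp : p ∈ Icc (0 : ℝ) 1) (u : ℝ) : posteriorSign p u ^ 2 ≤ 1 :=
  (sq_le_one_iff_abs_le_one _).2 (abs_posteriorSign_le hp u)

lemma monotone_posteriorSign (hp : p ∈ Icc (0 : ℝ) 1) : Monotone (posteriorSign p) :=
  monotone_of_deriv_nonneg (fun u => (hasDerivAt_posteriorSign hp u).differentiableAt) fun u => by
    rw [(hasDerivAt_posteriorSign hp u).deriv]
    linarith [posteriorSign_sq_le hp u]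

lemma abs_posteriorSign_sub_le (hp : p ∈ Icc (0 : ℝ) 1) (u v : ℝ) :
    |posteriorSign p u - posteriorSign p v| ≤ |u - v| := by
  have := Convex.norm_image_sub_le_of_norm_hasDerivWithin_le (s := univ) (C := 1)
    (fun x _ => (hasDerivAt_posteriorSign hp x).hasDerivWithinAt) (fun x _ => ?_) convex_univ
    (mem_univ v) (mem_univ u)
  · simpa using this
  · rw [Real.norm_eq_abs, abs_le]
    constructor <;> nlinarith [posteriorSign_sq_le hp x, sq_nonneg (posteriorSign p x)]

lemma eq_of_posteriorSign_eq_zero (hp : p ∈ Icc (0 : ℝ) 1) {u v : ℝ}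
    (hu : posteriorSign p u = 0) (hv : posteriorSign p v = 0) : u = v := by
  have key : ∀ w, posteriorSign p w = 0 → p * Real.exp (2 * w) = 1 - p := by
    intro w hw
    rw [posteriorSign, div_eq_zero_iff] at hw
    have h1 := hw.resolve_right (posteriorSign_denom_pos hp w).ne'
    have h2 : Real.exp w * Real.exp w = Real.exp (2 * w) := by rw [← Real.exp_add]; ring_nf
    have h3 : Real.exp (-w) * Real.exp w = 1 := by rw [← Real.exp_add]; simp
    rw [← h2]
    linear_combination Real.exp w * h1 + (1 - p) * h3
  have h1 := key u hu
  have h2 := key v hv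
  have hp0 : p ≠ 0 := by
    rintro rfl
    simp at h1
  have := Real.exp_injective (mul_left_cancel₀ hp0 (h1.trans h2.symm))
  linarith

lemma posteriorSign_neg (p u : ℝ) : posteriorSign p (-u) = -posteriorSign (1 - p) u := by
  rw [posteriorSign, posteriorSign, ← neg_div]
  congr 1 <;> simp only [neg_neg] <;> ring

lemma tendsto_posteriorSign_atTop (hp : 0 < p) :
    Tendsto (posteriorSign p) atTop (𝓝 1) := by
  have h0 : Tendsto (fun u : ℝ => Real.exp (-(2 * u))) atTop (𝓝 0) :=
    Real.tendsto_exp_neg_atTop_nhds_zero.comp (tendsto_id.const_mul_atTop (by norm_num))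
  have h1 : Tendsto (fun u : ℝ => (p - (1 - p) * Real.exp (-(2 * u))) /
      (p + (1 - p) * Real.exp (-(2 * u)))) atTop (𝓝 ((p - (1 - p) * 0) / (p + (1 - p) * 0))) :=
    (tendsto_const_nhds.sub (h0.const_mul _)).div (tendsto_const_nhds.add (h0.const_mul _))
      (by simpa using hp.ne')
  rw [show (p - (1 - p) * 0) / (p + (1 - p) * 0) = 1 by simp [hp.ne']] at h1
  refine h1.congr fun u => ?_
  have h3 : Real.exp (-u) = Real.exp u * Real.exp (-(2 * u)) := by
    rw [← Real.exp_add]; ring_nf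
  rw [posteriorSign, h3, ← mul_div_mul_left _ _ (Real.exp_pos u).ne']
  congr 1 <;> ring

lemma tendsto_posteriorSign_atBot (hp : p < 1) :
    Tendsto (posteriorSign p) atBot (𝓝 (-1)) := by
  have h := ((tendsto_posteriorSign_atTop (p := 1 - p) (by linarith)).comp
    tendsto_neg_atBot_atTop).neg
  refine h.congr fun u => ?_
  have := posteriorSign_neg p (-u)
  simp only [neg_neg] at this
  simp [this]

lemma pos_of_posteriorSign_pos (hp : p ∈ Icc (0 : ℝ) 1) {u : ℝ} (h : 0 < posteriorSign p u) :
    0 < p := by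
  refine hp.1.lt_of_ne ?_
  rintro rfl
  simp [posteriorSign] at h
  linarith

lemma lt_one_of_posteriorSign_neg (hp : p ∈ Icc (0 : ℝ) 1) {u : ℝ} (h : posteriorSign p u < 0) :
    p < 1 := by
  refine hp.2.lt_of_ne ?_
  rintro rfl
  simp [posteriorSign] at h
  linarith

end posteriorSign

/-! ### Gaussian measures -/

section Gaussian

variable {d : ℕ}

instance isOpenPosMeasure_stdGaussian : (stdGaussian (Vec d)).IsOpenPosMeasure := by
  have : (gaussianReal 0 1).IsOpenPosMeasure :=
    (gaussianReal_absolutelyContinuous' 0 one_ne_zero).isOpenPosMeasure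
  rw [← map_pi_eq_stdGaussian]
  exact (PiLp.continuous_toLp 2 _).isOpenPosMeasure_map (WithLp.toLp_surjective 2)

/-- The **Cameron–Martin formula** for the standard Gaussian measure. -/
lemma map_const_add_stdGaussian (m : Vec d) :
    (stdGaussian (Vec d)).map (fun y => m + y) = (stdGaussian (Vec d)).withDensity
      (fun y => ENNReal.ofReal (Real.exp (⟪m, y⟫ - ‖m‖ ^ 2 / 2))) := by
  have hmeas : Measurable fun y : Vec d => ENNReal.ofReal (Real.exp (⟪m, y⟫ - ‖m‖ ^ 2 / 2)) := by
    fun_prop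
  -- a Gaussian integral with a complex exponent, coordinate by coordinate
  have key : ∀ t : Vec d, ∫ y, Complex.exp (⟪m, y⟫ + ⟪y, t⟫ * Complex.I) ∂stdGaussian (Vec d) =
      Complex.exp (‖m‖ ^ 2 / 2 + ⟪m, t⟫ * Complex.I - ‖t‖ ^ 2 / 2) := by
    intro t
    rw [← map_pi_eq_stdGaussian, integral_map (by fun_prop)
      (Measurable.aestronglyMeasurable (by fun_prop))]
    have h1 : ∀ y : Fin d → ℝ, Complex.exp (⟪m, WithLp.toLp 2 y⟫ + ⟪WithLp.toLp 2 y, t⟫ * Complex.I)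
        = ∏ i, Complex.exp ((m i + t i * Complex.I) * y i) := by
      intro y
      rw [← Complex.exp_sum]
      congr 1
      simp only [PiLp.inner_apply, RCLike.inner_apply, conj_trivial, Complex.ofReal_sum,
        Finset.sum_mul, ← Finset.sum_add_distrib, Complex.ofReal_mul]
      exact Finset.sum_congr rfl fun i _ => by ring
    simp_rw [h1]
    rw [integral_fintype_prod_eq_prod
      (f := fun i (x : ℝ) => Complex.exp ((m i + t i * Complex.I) * x))]
    have h2 : ∀ z : ℂ, ∫ x : ℝ, Complex.exp (z * x) ∂gaussianReal 0 1 =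
        Complex.exp (z ^ 2 / 2) := by
      intro z
      simpa [complexMGF] using complexMGF_id_gaussianReal (μ := 0) (v := 1) z
    simp_rw [h2]
    rw [← Complex.exp_sum]
    congr 1
    rw [← Complex.ofReal_pow, ← Complex.ofReal_pow, EuclideanSpace.real_norm_sq_eq,
      EuclideanSpace.real_norm_sq_eq]
    simp only [PiLp.inner_apply, RCLike.inner_apply, conj_trivial, Complex.ofReal_sum,
        Finset.sum_mul, ← Finset.sum_add_distrib, Complex.ofReal_mul, Finset.sum_div,
        ← Finset.sum_sub_distrib, Complex.ofReal_pow]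
    refine Finset.sum_congr rfl fun i _ => ?_
    linear_combination (t i : ℂ) ^ 2 / 2 * Complex.I_sq
  have hfin : IsFiniteMeasure ((stdGaussian (Vec d)).withDensity
      (fun y => ENNReal.ofReal (Real.exp (⟪m, y⟫ - ‖m‖ ^ 2 / 2)))) := by
    refine isFiniteMeasure_withDensity_ofReal (Integrable.hasFiniteIntegral ?_)
    by_contra hint
    have h0 := key 0
    have h3 : ∫ y, Real.exp ⟪m, y⟫ ∂stdGaussian (Vec d) = Real.exp (‖m‖ ^ 2 / 2) := by
      have : ∀ y : Vec d, Complex.exp (⟪m, y⟫ + ⟪y, (0 : Vec d)⟫ * Complex.I) =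
          ((Real.exp ⟪m, y⟫ : ℝ) : ℂ) := by
        intro y; simp
      simp_rw [this] at h0
      rw [integral_complex_ofReal] at h0
      have h4 : Complex.exp (‖m‖ ^ 2 / 2 + ⟪m, (0 : Vec d)⟫ * Complex.I - ‖(0 : Vec d)‖ ^ 2 / 2) =
        ((Real.exp (‖m‖ ^ 2 / 2) : ℝ) : ℂ) := by simp
      rw [h4] at h0
      exact_mod_cast h0
    have h5 : ¬ Integrable (fun y => Real.exp ⟪m, y⟫) (stdGaussian (Vec d)) := by
      intro h6
      refine hint ((h6.mul_const (Real.exp (-(‖m‖ ^ 2 / 2)))).congr (ae_of_all _ fun y => ?_))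
      simp only
      rw [← Real.exp_add]
      rfl
    rw [integral_undef h5] at h3
    exact (Real.exp_pos _).ne h3
  have : IsProbabilityMeasure ((stdGaussian (Vec d)).map (fun y => m + y)) :=
    Measure.isProbabilityMeasure_map (by fun_prop)
  refine Measure.ext_of_charFun (funext fun t => ?_)
  rw [charFun_apply, charFun_apply, integral_map (by fun_prop)
    (Measurable.aestronglyMeasurable (by fun_prop)),
    integral_withDensity_eq_integral_toReal_smul hmeas (by simp)]
  have hl : ∀ y : Vec d, Complex.exp (⟪m + y, t⟫ * Complex.I) =
      Complex.exp (⟪m, t⟫ * Complex.I) * Complex.exp (⟪y, t⟫ * Complex.I) := by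
    intro y
    rw [← Complex.exp_add, inner_add_left]
    push_cast
    ring_nf
  have hr : ∀ y : Vec d, (ENNReal.ofReal (Real.exp (⟪m, y⟫ - ‖m‖ ^ 2 / 2))).toReal •
      Complex.exp (⟪y, t⟫ * Complex.I) =
      Complex.exp (-(‖m‖ ^ 2 / 2)) * Complex.exp (⟪m, y⟫ + ⟪y, t⟫ * Complex.I) := by
    intro y
    rw [ENNReal.toReal_ofReal (Real.exp_pos _).le, Complex.real_smul, Complex.ofReal_exp,
      ← Complex.exp_add, ← Complex.exp_add]
    push_cast
    ring_nf
  simp_rw [hl, hr]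
  rw [integral_const_mul, integral_const_mul, key, ← charFun_apply, charFun_stdGaussian,
    ← Complex.exp_add, ← Complex.exp_add]
  ring_nf

lemma integrable_exp_smul_stdGaussian_iff {E : Type*} [NormedAddCommGroup E] [NormedSpace ℝ E]
    (m : Vec d) {f : Vec d → E}
    (hf : AEStronglyMeasurable f ((stdGaussian (Vec d)).map (fun y => m + y))) :
    Integrable (fun y => Real.exp (⟪m, y⟫ - ‖m‖ ^ 2 / 2) • f y) (stdGaussian (Vec d)) ↔
      Integrable (fun y => f (m + y)) (stdGaussian (Vec d)) := by
  have h := integrable_withDensity_iff_integrable_smul' (μ := stdGaussian (Vec d))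
    (f := fun y : Vec d => ENNReal.ofReal (Real.exp (⟪m, y⟫ - ‖m‖ ^ 2 / 2))) (by fun_prop) (by simp)
    (g := f)
  rw [← map_const_add_stdGaussian, integrable_map_measure hf (by fun_prop)] at h
  simp only [ENNReal.toReal_ofReal (Real.exp_pos _).le] at h
  exact h.symm

lemma integral_exp_smul_stdGaussian {E : Type*} [NormedAddCommGroup E] [NormedSpace ℝ E]
    (m : Vec d) {f : Vec d → E}
    (hf : AEStronglyMeasurable f ((stdGaussian (Vec d)).map (fun y => m + y))) :
    ∫ y, Real.exp (⟪m, y⟫ - ‖m‖ ^ 2 / 2) • f y ∂stdGaussian (Vec d) =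
      ∫ y, f (m + y) ∂stdGaussian (Vec d) := by
  rw [← integral_map (by fun_prop) hf, map_const_add_stdGaussian,
    integral_withDensity_eq_integral_toReal_smul (by fun_prop) (by simp)]
  simp only [ENNReal.toReal_ofReal (Real.exp_pos _).le]

/-- Integrals against a pair of independent standard Gaussian vectors are invariant under
rotations of the pair. -/
lemma integral_rotate_stdGaussian {E : Type*} [NormedAddCommGroup E] [NormedSpace ℝ E]
    {c s : ℝ} (hcs : c ^ 2 + s ^ 2 = 1) {f : Vec d × Vec d → E}
    (hf : StronglyMeasurable f) :
    ∫ q, f (c • q.1 - s • q.2, s • q.1 + c • q.2)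
        ∂(stdGaussian (Vec d)).prod (stdGaussian (Vec d)) =
      ∫ q, f q ∂(stdGaussian (Vec d)).prod (stdGaussian (Vec d)) := by
  obtain ⟨θ, h1, h2⟩ : ∃ θ : ℝ, Real.cos θ = c ∧ Real.sin θ = -s := by
    have hn : ‖(⟨c, -s⟩ : ℂ)‖ = 1 := by
      rw [← sq_eq_sq₀ (norm_nonneg _) zero_le_one, Complex.sq_norm, Complex.normSq_mk]
      linarith
    have hz : (⟨c, -s⟩ : ℂ) ≠ 0 := by
      intro h; rw [h] at hn; simp at hn
    exact ⟨Complex.arg ⟨c, -s⟩, by rw [Complex.cos_arg hz, hn]; simp,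
      by rw [Complex.sin_arg, hn]; simp⟩
  have hrot := IsGaussian.map_rotation_eq_self (μ := stdGaussian (Vec d))
    integral_id_stdGaussian θ
  conv_rhs => rw [← hrot, integral_map (by fun_prop) hf.aestronglyMeasurable]
  refine integral_congr_ae (ae_of_all _ fun q => ?_)
  simp only [ContinuousLinearMap.rotation_apply, h1, h2]
  congr 1
  ext i <;> simp [sub_eq_add_neg]

end Gaussian

/-! ### The velocity field -/

/-- The conditional variance `(1 - τ)² + τ² σ²` of `(1 - τ) z + τ a` given the mode of `a`. -/
noncomputable def modeVar (σ τ : ℝ) : ℝ := (1 - τ) ^ 2 + (τ * σ) ^ 2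

/-- The coefficient of `x` in `E[a - z | (1 - τ) z + τ a = x]`. -/
noncomputable def linearCoeff (σ τ : ℝ) : ℝ := (τ * σ ^ 2 - (1 - τ)) / modeVar σ τ

/-- The coefficient of `E[ε | x] r` in `E[a - z | (1 - τ) z + τ a = x]`, where `ε r` is the mode
of `a`. -/
noncomputable def modeCoeff (σ τ : ℝ) : ℝ := (1 - τ) / modeVar σ τ

/-- The conditional expectation `E[a - z | (1 - τ) z + τ a = x]`, in closed form. -/
noncomputable def conditionalDrift (p σ τ : ℝ) {d : ℕ} (r x : Vec d) : Vec d :=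
  linearCoeff σ τ • x + (modeCoeff σ τ * posteriorSign p (τ * ⟪r, x⟫ / modeVar σ τ)) • r

/-- The right derivative of the time dilation. -/
noncomputable def timeDilationDeriv (κ : ℝ) (d : ℕ) (t : ℝ) : ℝ :=
  if t < 1 / 2 then 2 * κ / √(d : ℝ) else 2 * (1 - κ / √(d : ℝ))

/-- The probability flow velocity `E[İ_t | I_t = x]`, in closed form. -/
noncomputable def flowVelocity (p σ κ : ℝ) {d : ℕ} (r : Vec d) (t : ℝ) (x : Vec d) : Vec d :=
  timeDilationDeriv κ d t • conditionalDrift p σ (timeDilation κ d t) r x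

lemma modeVar_pos {σ : ℝ} (hσ : 0 < σ) (τ : ℝ) : 0 < modeVar σ τ := by
  unfold modeVar
  rcases eq_or_ne τ 0 with rfl | h
  · norm_num
  · have : 0 < (τ * σ) ^ 2 := by positivity
    positivity

lemma continuous_conditionalDrift {p : ℝ} (hp : p ∈ Icc (0 : ℝ) 1) (σ τ : ℝ) {d : ℕ} (r : Vec d) :
    Continuous (conditionalDrift p σ τ r) := by
  have := continuous_posteriorSign hp
  unfold conditionalDrift
  fun_prop

lemma continuous_flowVelocity {p : ℝ} (hp : p ∈ Icc (0 : ℝ) 1) (σ κ : ℝ) {d : ℕ} (r : Vec d)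
    (t : ℝ) : Continuous (flowVelocity p σ κ r t) := by
  have := continuous_conditionalDrift hp σ (timeDilation κ d t) r
  unfold flowVelocity
  fun_prop

lemma hasDerivWithinAt_timeDilation (κ : ℝ) (d : ℕ) (t : ℝ) :
    HasDerivWithinAt (timeDilation κ d) (timeDilationDeriv κ d t) (Ici t) t := by
  unfold timeDilationDeriv
  split_ifs with h
  · have h1 : HasDerivAt (fun s : ℝ => 2 * κ * s / √(d : ℝ)) (2 * κ / √(d : ℝ)) t := by
      simpa using ((hasDerivAt_id t).const_mul (2 * κ)).div_const √(d : ℝ)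
    refine (h1.congr_of_eventuallyEq ?_).hasDerivWithinAt
    filter_upwards [Iio_mem_nhds h] with s hs
    exact if_pos (le_of_lt hs)
  · have h1 : HasDerivAt (fun s : ℝ => κ / √(d : ℝ) + (1 - κ / √(d : ℝ)) * (2 * s - 1))
        (2 * (1 - κ / √(d : ℝ))) t := by
      have := ((((hasDerivAt_id t).const_mul 2).sub_const 1).const_mul
        (1 - κ / √(d : ℝ))).const_add (κ / √(d : ℝ))
      refine this.congr_deriv (by ring)
    have h2 : ∀ s ∈ Ici t, timeDilation κ d s =
        κ / √(d : ℝ) + (1 - κ / √(d : ℝ)) * (2 * s - 1) := by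
      intro s hs
      have hs' : t ≤ s := hs
      unfold timeDilation
      split_ifs with h3
      · have : s = 1 / 2 := le_antisymm h3 (by linarith)
        subst this
        ring
      · rfl
    exact h1.hasDerivWithinAt.congr h2 (h2 t self_mem_Ici)

lemma interpolantDeriv_eq (κ : ℝ) {d : ℕ} (t : ℝ) (ω : Vec d × Vec d) :
    interpolantDeriv κ t ω = timeDilationDeriv κ d t • (ω.2 - ω.1) := by
  have h := hasDerivWithinAt_timeDilation κ d t
  have h1 := ((h.const_sub 1).smul_const ω.1).add (h.smul_const ω.2)
  refine (h1.derivWithin (uniqueDiffWithinAt_Ici t)).trans ?_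
  module

section component

variable {d : ℕ}

/-- The pair (noise, data) built from independent standard Gaussian vectors `(z, w)`, when the data
lie in the mode centred at `r`. -/
def modePair (σ : ℝ) (r : Vec d) (q : Vec d × Vec d) : Vec d × Vec d := (q.1, r + σ • q.2)

lemma continuous_modePair (σ : ℝ) (r : Vec d) : Continuous (modePair σ r) := by
  unfold modePair
  fun_prop

lemma noiseDataLaw_eq (p σ : ℝ) (r : Vec d) : noiseDataLaw p σ r =
    ENNReal.ofReal p • ((stdGaussian (Vec d)).prod (stdGaussian (Vec d))).map (modePair σ r) +
    ENNReal.ofReal (1 - p) •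
      ((stdGaussian (Vec d)).prod (stdGaussian (Vec d))).map (modePair σ (-r)) := by
  have h : ∀ r' : Vec d, ((stdGaussian (Vec d)).prod (stdGaussian (Vec d))).map (modePair σ r') =
      (stdGaussian (Vec d)).prod ((stdGaussian (Vec d)).map (fun w => r' + σ • w)) := by
    intro r'
    have := Measure.map_prod_map (stdGaussian (Vec d)) (stdGaussian (Vec d)) measurable_id
      (show Measurable fun w : Vec d => r' + σ • w by fun_prop)
    rw [Measure.map_id] at this
    rw [this]
    rfl
  have (r' : Vec d) : IsProbabilityMeasure ((stdGaussian (Vec d)).map (fun w => r' + σ • w)) :=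
    Measure.isProbabilityMeasure_map (by fun_prop)
  rw [h, h, noiseDataLaw, gaussianMixture, Measure.prod_add, Measure.prod_smul_right,
    Measure.prod_smul_right]

lemma integrable_noiseDataLaw {E : Type*} [NormedAddCommGroup E] {p σ : ℝ} {r : Vec d}
    {F : Vec d × Vec d → E} (hF : StronglyMeasurable F)
    (h : ∀ r', Integrable (fun q => F (modePair σ r' q))
      ((stdGaussian (Vec d)).prod (stdGaussian (Vec d)))) :
    Integrable F (noiseDataLaw p σ r) := by
  rw [noiseDataLaw_eq]
  refine Integrable.add_measure ?_ ?_ <;>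
  · refine Integrable.smul_measure ?_ ENNReal.ofReal_ne_top
    rw [integrable_map_measure hF.aestronglyMeasurable (continuous_modePair _ _).aemeasurable]
    exact h _

lemma integral_noiseDataLaw {E : Type*} [NormedAddCommGroup E] [NormedSpace ℝ E] {p σ : ℝ}
    (hp : p ∈ Icc (0 : ℝ) 1) {r : Vec d}
    {F : Vec d × Vec d → E} (hF : StronglyMeasurable F)
    (h : ∀ r', Integrable (fun q => F (modePair σ r' q))
      ((stdGaussian (Vec d)).prod (stdGaussian (Vec d)))) :
    ∫ ω, F ω ∂noiseDataLaw p σ r =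
      p • ∫ q, F (modePair σ r q) ∂(stdGaussian (Vec d)).prod (stdGaussian (Vec d)) +
      (1 - p) • ∫ q, F (modePair σ (-r) q) ∂(stdGaussian (Vec d)).prod (stdGaussian (Vec d)) := by
  have h' : ∀ r', Integrable F
      (((stdGaussian (Vec d)).prod (stdGaussian (Vec d))).map (modePair σ r')) := fun r' => by
    rw [integrable_map_measure hF.aestronglyMeasurable (continuous_modePair _ _).aemeasurable]
    exact h _
  rw [noiseDataLaw_eq, integral_add_measure ((h' _).smul_measure ENNReal.ofReal_ne_top)
    ((h' _).smul_measure ENNReal.ofReal_ne_top), integral_smul_measure, integral_smul_measure,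
    integral_map (continuous_modePair _ _).aemeasurable hF.aestronglyMeasurable,
    integral_map (continuous_modePair _ _).aemeasurable hF.aestronglyMeasurable,
    ENNReal.toReal_ofReal hp.1, ENNReal.toReal_ofReal (by linarith [hp.2])]

instance isProbabilityMeasure_modePair (σ : ℝ) (r : Vec d) : IsProbabilityMeasure
    (((stdGaussian (Vec d)).prod (stdGaussian (Vec d))).map (modePair σ r)) :=
  Measure.isProbabilityMeasure_map (continuous_modePair _ _).aemeasurable

lemma isProbabilityMeasure_noiseDataLaw {p : ℝ} (hp : p ∈ Icc (0 : ℝ) 1) (σ : ℝ) (r : Vec d) :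
    IsProbabilityMeasure (noiseDataLaw p σ r) := by
  constructor
  rw [noiseDataLaw_eq]
  simp only [Measure.add_apply, Measure.smul_apply, measure_univ, smul_eq_mul, mul_one]
  rw [← ENNReal.ofReal_add hp.1 (by linarith [hp.2])]
  simp

/-- Write the noise of the interpolant as `√V y` for a standard Gaussian `y`, and let `y'` be
standard Gaussian and independent of `y`. An integral over `(z, w)` becomes one over `(y, y')`. -/
lemma integral_modePair_rotate {E : Type*} [NormedAddCommGroup E] [NormedSpace ℝ E]
    {σ : ℝ} (hσ : 0 < σ) (τ : ℝ) (r : Vec d) {F : Vec d → Vec d → E}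
    (hF : StronglyMeasurable (Function.uncurry F)) :
    ∫ q, F ((1 - τ) • q.1 + τ • (r + σ • q.2)) ((r + σ • q.2) - q.1)
        ∂(stdGaussian (Vec d)).prod (stdGaussian (Vec d)) =
    ∫ q, F (τ • r + √(modeVar σ τ) • q.1)
        (r + ((τ * σ ^ 2 - (1 - τ)) / √(modeVar σ τ)) • q.1 + (σ / √(modeVar σ τ)) • q.2)
        ∂(stdGaussian (Vec d)).prod (stdGaussian (Vec d)) := by
  have hV := modeVar_pos hσ τ
  have hs := Real.sqrt_pos.2 hV
  have hsq : √(modeVar σ τ) ^ 2 = (1 - τ) ^ 2 + (τ * σ) ^ 2 := Real.sq_sqrt hV.le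
  set v := √(modeVar σ τ)
  rw [← integral_rotate_stdGaussian (c := (1 - τ) / v) (s := τ * σ / v)]
  · refine integral_congr_ae (ae_of_all _ fun q => ?_)
    have hc : (1 - τ) * ((1 - τ) / v) + τ * σ * (τ * σ / v) = v := by
      field_simp
      linarith
    have e1 : (1 - τ) • (((1 - τ) / v) • q.1 - (τ * σ / v) • q.2) +
        τ • (r + σ • ((τ * σ / v) • q.1 + ((1 - τ) / v) • q.2)) = τ • r + v • q.1 := by
      conv_rhs => rw [← hc]
      module
    have e2 : (r + σ • ((τ * σ / v) • q.1 + ((1 - τ) / v) • q.2)) -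
        (((1 - τ) / v) • q.1 - (τ * σ / v) • q.2) =
        r + ((τ * σ ^ 2 - (1 - τ)) / v) • q.1 + (σ / v) • q.2 := by
      match_scalars <;> field_simp
      ring
    simp only [e1, e2]
  · field_simp
    linarith
  · exact hF.comp_measurable (g := fun q : Vec d × Vec d =>
      ((1 - τ) • q.1 + τ • (r + σ • q.2), (r + σ • q.2) - q.1)) (by fun_prop)

lemma integral_comp_interpolant_modePair {E : Type*} [NormedAddCommGroup E] [NormedSpace ℝ E]
    {σ : ℝ} (hσ : 0 < σ) (τ : ℝ) (r : Vec d) {G : Vec d → E} (hG : StronglyMeasurable G) :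
    ∫ q, G ((1 - τ) • q.1 + τ • (r + σ • q.2)) ∂(stdGaussian (Vec d)).prod (stdGaussian (Vec d)) =
    ∫ y, Real.exp (⟪(τ / √(modeVar σ τ)) • r, y⟫ - ‖(τ / √(modeVar σ τ)) • r‖ ^ 2 / 2) •
        G (√(modeVar σ τ) • y) ∂stdGaussian (Vec d) := by
  rw [integral_modePair_rotate hσ τ r (F := fun x _ => G x) (hG.comp_measurable measurable_fst),
    integral_fun_fst (fun y => G (τ • r + √(modeVar σ τ) • y)), integral_exp_smul_stdGaussian]
  · have hs := (Real.sqrt_pos.2 (modeVar_pos hσ τ)).ne'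
    simp only [probReal_univ, one_smul, smul_add, smul_smul, mul_div_cancel₀ _ hs]
  · exact (hG.comp_measurable (by fun_prop)).aestronglyMeasurable

lemma integral_indicator_smul_prod (r c : Vec d) (v k l : ℝ) {B : Set (Vec d)}
    (hB : MeasurableSet B) :
    ∫ q, B.indicator (fun _ => (1 : ℝ)) (c + v • q.1) • (r + k • q.1 + l • q.2)
        ∂(stdGaussian (Vec d)).prod (stdGaussian (Vec d)) =
    ∫ y, B.indicator (fun _ => (1 : ℝ)) (c + v • y) • (r + k • y) ∂stdGaussian (Vec d) := by
  have hφ : StronglyMeasurable (B.indicator (fun _ => (1 : ℝ))) :=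
    stronglyMeasurable_const.indicator hB
  have hid : Integrable (fun y : Vec d => y) (stdGaussian (Vec d)) := IsGaussian.integrable_id
  have hφc : StronglyMeasurable fun y : Vec d => B.indicator (fun _ => (1 : ℝ)) (c + v • y) :=
    hφ.comp_measurable (by fun_prop)
  have hφb : ∀ y : Vec d, ‖B.indicator (fun _ => (1 : ℝ)) (c + v • y)‖ ≤ 1 := fun y => by
    by_cases h : c + v • y ∈ B <;> simp [h]
  have h : ∀ q : Vec d × Vec d, B.indicator (fun _ => (1 : ℝ)) (c + v • q.1) •
      (r + k • q.1 + l • q.2) = B.indicator (fun _ => (1 : ℝ)) (c + v • q.1) • (r + k • q.1) +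
        B.indicator (fun _ => (1 : ℝ)) (c + v • q.1) • (l • q.2) := fun q => smul_add _ _ _
  simp_rw [h]
  have hid' : Integrable (fun y : Vec d => r + k • y) (stdGaussian (Vec d)) :=
    (integrable_const r).add (hid.smul k)
  have hi1 : Integrable (fun y => B.indicator (fun _ => (1 : ℝ)) (c + v • y) • (r + k • y))
      (stdGaussian (Vec d)) :=
    hid'.bdd_smul 1 hφc.aestronglyMeasurable (ae_of_all _ hφb)
  have hi2 : Integrable (fun y => B.indicator (fun _ => (1 : ℝ)) (c + v • y))
      (stdGaussian (Vec d)) :=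
    Integrable.of_bound hφc.aestronglyMeasurable 1 (ae_of_all _ hφb)
  have hil : Integrable (fun y : Vec d => l • y) (stdGaussian (Vec d)) := hid.smul l
  rw [integral_add (hi1.comp_fst (stdGaussian (Vec d))) (hi2.smul_prod hil),
    integral_fun_fst (fun y => B.indicator (fun _ => (1 : ℝ)) (c + v • y) • (r + k • y)),
    integral_prod_smul (fun y => B.indicator (fun _ => (1 : ℝ)) (c + v • y)) (fun y => l • y),
    integral_smul, integral_id_stdGaussian]
  simp

lemma integral_indicator_drift_modePair {σ : ℝ} (hσ : 0 < σ) (τ : ℝ) (r : Vec d) {B : Set (Vec d)}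
    (hB : MeasurableSet B) :
    ∫ q, B.indicator (fun _ => (1 : ℝ)) ((1 - τ) • q.1 + τ • (r + σ • q.2)) •
        ((r + σ • q.2) - q.1) ∂(stdGaussian (Vec d)).prod (stdGaussian (Vec d)) =
    ∫ y, Real.exp (⟪(τ / √(modeVar σ τ)) • r, y⟫ - ‖(τ / √(modeVar σ τ)) • r‖ ^ 2 / 2) •
        (B.indicator (fun _ => (1 : ℝ)) (√(modeVar σ τ) • y) •
          (r + ((τ * σ ^ 2 - (1 - τ)) / √(modeVar σ τ)) • (y - (τ / √(modeVar σ τ)) • r)))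
          ∂stdGaussian (Vec d) := by
  have hφ : StronglyMeasurable (B.indicator (fun _ => (1 : ℝ))) :=
    stronglyMeasurable_const.indicator hB
  have hs := (Real.sqrt_pos.2 (modeVar_pos hσ τ)).ne'
  have hrot := integral_modePair_rotate hσ τ r (F := fun x u => B.indicator (fun _ => (1 : ℝ)) x • u)
    ((hφ.comp_measurable measurable_fst).smul measurable_snd.stronglyMeasurable)
  rw [hrot, integral_indicator_smul_prod _ _ _ _ _ hB]
  generalize (τ * σ ^ 2 - (1 - τ)) / √(modeVar σ τ) = k
  have hτ : τ • r = √(modeVar σ τ) • ((τ / √(modeVar σ τ)) • r) := by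
    rw [smul_smul, mul_div_cancel₀ _ hs]
  rw [hτ]
  generalize √(modeVar σ τ) = v
  generalize (τ / v) • r = m
  rw [integral_exp_smul_stdGaussian m (f := fun y => B.indicator (fun _ => (1 : ℝ)) (v • y) •
    (r + k • (y - m)))]
  · simp only [smul_add, add_sub_cancel_left]
  · refine StronglyMeasurable.aestronglyMeasurable ?_
    exact (hφ.comp_measurable (by fun_prop)).smul (by fun_prop)

end component

section velocity

variable {d : ℕ} {p σ : ℝ}

lemma integrable_conditionalDrift {α : Type*} [MeasurableSpace α] {μ : Measure α}
    [IsFiniteMeasure μ] (hp : p ∈ Icc (0 : ℝ) 1) (σ τ : ℝ) (r : Vec d) {f : α → Vec d}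
    (hf : Integrable f μ) : Integrable (fun a => conditionalDrift p σ τ r (f a)) μ := by
  refine (hf.smul (linearCoeff σ τ)).add (Integrable.smul_const ?_ r)
  have h := continuous_posteriorSign hp
  refine Integrable.const_mul (Integrable.of_bound ?_ 1 (ae_of_all _ fun a => ?_)) _
  · have h2 : Continuous fun x : Vec d => posteriorSign p (τ * ⟪r, x⟫ / modeVar σ τ) := by fun_prop
    exact h2.comp_aestronglyMeasurable hf.1
  · exact abs_posteriorSign_le hp _

lemma integrable_exp_smul_indicator (m : Vec d) (v : ℝ) {B : Set (Vec d)} (hB : MeasurableSet B)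
    {H : Vec d → Vec d} (hH : StronglyMeasurable H)
    (hi : ∀ c : Vec d, Integrable (fun y => H (c + y)) (stdGaussian (Vec d))) :
    Integrable (fun y => Real.exp (⟪m, y⟫ - ‖m‖ ^ 2 / 2) •
      (B.indicator (fun _ => (1 : ℝ)) (v • y) • H y)) (stdGaussian (Vec d)) := by
  have hφ : StronglyMeasurable fun y : Vec d => B.indicator (fun _ => (1 : ℝ)) (v • y) :=
    (stronglyMeasurable_const.indicator hB).comp_measurable (by fun_prop)
  rw [integrable_exp_smul_stdGaussian_iff m (f := fun y => B.indicator (fun _ => (1 : ℝ)) (v • y) •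
    H y) (hφ.smul hH).aestronglyMeasurable]
  refine (hi m).bdd_smul 1 (hφ.comp_measurable (by fun_prop)).aestronglyMeasurable
    (ae_of_all _ fun y => ?_)
  change ‖B.indicator (fun _ => (1 : ℝ)) (v • (m + y))‖ ≤ 1
  by_cases h : v • (m + y) ∈ B
  · rw [indicator_of_mem h, norm_one]
  · rw [indicator_of_notMem h, norm_zero]
    exact zero_le_one

/-- Bayes' rule for the two modes: mixing the mode-wise drifts with the mode-wise densities gives
the mixture density times `conditionalDrift`. -/
lemma mixture_drift_eq (hp : p ∈ Icc (0 : ℝ) 1) (hσ : 0 < σ) (τ : ℝ) (r y : Vec d) :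
    (p * Real.exp ⟪(τ / √(modeVar σ τ)) • r, y⟫) •
      (r + ((τ * σ ^ 2 - (1 - τ)) / √(modeVar σ τ)) • (y - (τ / √(modeVar σ τ)) • r)) +
    ((1 - p) * Real.exp (-⟪(τ / √(modeVar σ τ)) • r, y⟫)) •
      (-r + ((τ * σ ^ 2 - (1 - τ)) / √(modeVar σ τ)) • (y - (τ / √(modeVar σ τ)) • -r)) =
    (p * Real.exp ⟪(τ / √(modeVar σ τ)) • r, y⟫ +
      (1 - p) * Real.exp (-⟪(τ / √(modeVar σ τ)) • r, y⟫)) •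
        conditionalDrift p σ τ r (√(modeVar σ τ) • y) := by
  have hV := modeVar_pos hσ τ
  have hs := Real.sqrt_pos.2 hV
  have hsq : √(modeVar σ τ) ^ 2 = modeVar σ τ := Real.sq_sqrt hV.le
  have harg : τ * ⟪r, √(modeVar σ τ) • y⟫ / modeVar σ τ = ⟪(τ / √(modeVar σ τ)) • r, y⟫ := by
    rw [real_inner_smul_left, real_inner_smul_right]
    nth_rw 2 [← hsq]
    field_simp
  rw [conditionalDrift, harg]
  set u := ⟪(τ / √(modeVar σ τ)) • r, y⟫
  have hN : posteriorSign p u * (p * Real.exp u + (1 - p) * Real.exp (-u)) =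
      p * Real.exp u - (1 - p) * Real.exp (-u) :=
    div_mul_cancel₀ _ (posteriorSign_denom_pos hp u).ne'
  have hlin : linearCoeff σ τ * √(modeVar σ τ) = (τ * σ ^ 2 - (1 - τ)) / √(modeVar σ τ) := by
    rw [linearCoeff]
    nth_rw 1 [← hsq]
    field_simp
  have hmode : modeCoeff σ τ = 1 - (τ * σ ^ 2 - (1 - τ)) / √(modeVar σ τ) *
      (τ / √(modeVar σ τ)) := by
    rw [div_mul_div_comm, ← pow_two, hsq, modeCoeff, eq_sub_iff_add_eq, ← add_div,
      div_eq_one_iff_eq hV.ne', modeVar]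
    ring
  rw [smul_smul, hlin, hmode]
  generalize (τ * σ ^ 2 - (1 - τ)) / √(modeVar σ τ) = k at *
  generalize τ / √(modeVar σ τ) = l at *
  match_scalars
  · linear_combination (k * l - 1) * hN
  · ring

lemma integral_indicator_drift (hp : p ∈ Icc (0 : ℝ) 1) (hσ : 0 < σ) (τ : ℝ) (r : Vec d)
    {B : Set (Vec d)} (hB : MeasurableSet B) :
    ∫ ω, B.indicator (fun _ => (1 : ℝ)) ((1 - τ) • ω.1 + τ • ω.2) • (ω.2 - ω.1)
        ∂noiseDataLaw p σ r =
    ∫ ω, B.indicator (fun _ => (1 : ℝ)) ((1 - τ) • ω.1 + τ • ω.2) •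
        conditionalDrift p σ τ r ((1 - τ) • ω.1 + τ • ω.2) ∂noiseDataLaw p σ r := by
  have hφ : StronglyMeasurable (B.indicator (fun _ => (1 : ℝ))) :=
    stronglyMeasurable_const.indicator hB
  have hφb : ∀ y : Vec d, ‖B.indicator (fun _ => (1 : ℝ)) y‖ ≤ 1 := fun y => by
    by_cases h : y ∈ B <;> simp [h]
  have hcd := (continuous_conditionalDrift hp σ τ r).stronglyMeasurable
  have hid : Integrable (fun y : Vec d => y) (stdGaussian (Vec d)) := IsGaussian.integrable_id
  have hfst : Integrable (fun q : Vec d × Vec d => q.1)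
      ((stdGaussian (Vec d)).prod (stdGaussian (Vec d))) := hid.comp_fst _
  have hsnd : Integrable (fun q : Vec d × Vec d => q.2)
      ((stdGaussian (Vec d)).prod (stdGaussian (Vec d))) := hid.comp_snd _
  have hdata (r' : Vec d) : Integrable (fun q : Vec d × Vec d => r' + σ • q.2)
      ((stdGaussian (Vec d)).prod (stdGaussian (Vec d))) := (integrable_const r').add (hsnd.smul σ)
  have hI (r' : Vec d) : Integrable (fun q : Vec d × Vec d => (1 - τ) • q.1 + τ • (r' + σ • q.2))
      ((stdGaussian (Vec d)).prod (stdGaussian (Vec d))) :=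
    (hfst.smul (1 - τ)).add ((hdata r').smul τ)
  have hind (r' : Vec d) {H : Vec d × Vec d → Vec d}
      (hH : Integrable H ((stdGaussian (Vec d)).prod (stdGaussian (Vec d)))) :
      Integrable (fun q => B.indicator (fun _ => (1 : ℝ))
        ((1 - τ) • q.1 + τ • (r' + σ • q.2)) • H q)
        ((stdGaussian (Vec d)).prod (stdGaussian (Vec d))) :=
    hH.bdd_smul 1 (hφ.comp_measurable (by fun_prop)).aestronglyMeasurable
      (ae_of_all _ fun q => hφb _)
  have hG : ∀ H : Vec d → Vec d, StronglyMeasurable H →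
      StronglyMeasurable fun x => B.indicator (fun _ => (1 : ℝ)) x • H x := fun H hH => hφ.smul hH
  rw [integral_noiseDataLaw hp, integral_noiseDataLaw hp]
  rotate_left
  · exact (hφ.comp_measurable (by fun_prop)).smul (hcd.comp_measurable (by fun_prop))
  · exact fun r' => hind r' (integrable_conditionalDrift hp σ τ r (hI r'))
  · exact (hφ.comp_measurable (by fun_prop)).smul (by fun_prop)
  · exact fun r' => hind r' ((hdata r').sub hfst)
  simp only [modePair]
  rw [integral_indicator_drift_modePair hσ τ r hB, integral_indicator_drift_modePair hσ τ (-r) hB,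
    integral_comp_interpolant_modePair hσ τ r (hG _ hcd),
    integral_comp_interpolant_modePair hσ τ (-r) (hG _ hcd)]
  have key := mixture_drift_eq hp hσ τ r
  have hcd' : StronglyMeasurable fun y => conditionalDrift p σ τ r (√(modeVar σ τ) • y) :=
    hcd.comp_measurable (by fun_prop)
  have hcdi : ∀ c : Vec d, Integrable
      (fun y => conditionalDrift p σ τ r (√(modeVar σ τ) • (c + y))) (stdGaussian (Vec d)) :=
    fun c => integrable_conditionalDrift hp σ τ r (((integrable_const c).add hid).smul (√(modeVar σ τ)))
  generalize (τ * σ ^ 2 - (1 - τ)) / √(modeVar σ τ) = k at *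
  simp only [smul_neg] at key ⊢
  generalize √(modeVar σ τ) = v at *
  have haff : ∀ a m c : Vec d, Integrable (fun y => a + k • (c + y - m)) (stdGaussian (Vec d)) :=
    fun a m c => (integrable_const a).add
      ((((integrable_const c).add hid).sub (integrable_const m)).smul k)
  generalize (τ / v) • r = m at *
  rw [← integral_smul, ← integral_smul, ← integral_smul, ← integral_smul, ← integral_add,
    ← integral_add]
  · refine integral_congr_ae (ae_of_all _ fun y => ?_)
    have hy := congrArg (fun w => (Real.exp (-(‖m‖ ^ 2 / 2)) *
      B.indicator (fun _ => (1 : ℝ)) (v • y)) • w) (key y)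
    simp only [inner_neg_left, norm_neg, sub_eq_add_neg, Real.exp_add] at hy ⊢
    exact Eq.trans (by module) (hy.trans (by module))
  · exact (integrable_exp_smul_indicator m v hB hcd' hcdi).smul p
  · exact (integrable_exp_smul_indicator (-m) v hB hcd' hcdi).smul (1 - p)
  · exact (integrable_exp_smul_indicator m v hB (by fun_prop) (haff _ _)).smul p
  · exact (integrable_exp_smul_indicator (-m) v hB (by fun_prop) (haff _ _)).smul (1 - p)

lemma integrable_noise (p σ : ℝ) (r : Vec d) :
    Integrable (fun ω : Vec d × Vec d => ω.1) (noiseDataLaw p σ r) :=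
  integrable_noiseDataLaw (by fun_prop) fun _ =>
    Integrable.comp_fst (f := fun y : Vec d => y) IsGaussian.integrable_id _

lemma integrable_data (p σ : ℝ) (r : Vec d) :
    Integrable (fun ω : Vec d × Vec d => ω.2) (noiseDataLaw p σ r) := by
  refine integrable_noiseDataLaw (by fun_prop) fun r' => ?_
  have hid : Integrable (fun y : Vec d => y) (stdGaussian (Vec d)) := IsGaussian.integrable_id
  have h : Integrable (fun y : Vec d => r' + σ • y) (stdGaussian (Vec d)) :=
    (integrable_const r').add (hid.smul σ)
  exact h.comp_snd (stdGaussian (Vec d))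

lemma continuous_interpolant (κ t : ℝ) :
    Continuous (interpolant κ t : Vec d × Vec d → Vec d) := by
  unfold interpolant
  fun_prop

lemma setIntegral_flowVelocity (hp : p ∈ Icc (0 : ℝ) 1) (hσ : 0 < σ) (κ t : ℝ) (r : Vec d)
    {B : Set (Vec d)} (hB : MeasurableSet B) :
    ∫ ω in interpolant κ t ⁻¹' B, flowVelocity p σ κ r t (interpolant κ t ω) ∂noiseDataLaw p σ r =
      ∫ ω in interpolant κ t ⁻¹' B, timeDilationDeriv κ d t • (ω.2 - ω.1)
        ∂noiseDataLaw p σ r := by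
  have hm := (continuous_interpolant (d := d) κ t).measurable hB
  rw [← integral_indicator hm, ← integral_indicator hm]
  have h1 : ∀ H : Vec d × Vec d → Vec d, (interpolant κ t ⁻¹' B).indicator H =
      fun ω => B.indicator (fun _ => (1 : ℝ)) (interpolant κ t ω) • H ω := by
    intro H
    funext ω
    by_cases h : interpolant κ t ω ∈ B
    · rw [indicator_of_mem (show ω ∈ interpolant κ t ⁻¹' B from h), indicator_of_mem h, one_smul]
    · rw [indicator_of_notMem (show ω ∉ interpolant κ t ⁻¹' B from h), indicator_of_notMem h,
        zero_smul]
  rw [h1, h1]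
  simp only [flowVelocity, interpolant]
  simp_rw [smul_comm _ (timeDilationDeriv κ d t)]
  rw [integral_smul, integral_smul, integral_indicator_drift hp hσ _ r hB]

lemma flowVelocity_ae_eq_condExp (hp : p ∈ Icc (0 : ℝ) 1) (hσ : 0 < σ) (κ t : ℝ) (r : Vec d) :
    (fun ω => flowVelocity p σ κ r t (interpolant κ t ω)) =ᵐ[noiseDataLaw p σ r]
      (noiseDataLaw p σ r)[interpolantDeriv κ t |
        MeasurableSpace.comap (interpolant κ t) inferInstance] := by
  have hprob := isProbabilityMeasure_noiseDataLaw hp σ r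
  have hI : Integrable (fun ω : Vec d × Vec d => interpolant κ t ω) (noiseDataLaw p σ r) :=
    ((integrable_noise p σ r).smul (1 - timeDilation κ d t)).add
      ((integrable_data p σ r).smul (timeDilation κ d t))
  have hvI : Integrable (fun ω => flowVelocity p σ κ r t (interpolant κ t ω))
      (noiseDataLaw p σ r) := by
    simp only [flowVelocity]
    exact (integrable_conditionalDrift hp σ _ r hI).smul (timeDilationDeriv κ d t)
  rw [funext (interpolantDeriv_eq κ t)]
  refine ae_eq_condExp_of_forall_setIntegral_eq (continuous_interpolant κ t).measurable.comap_le
    (((integrable_data p σ r).sub (integrable_noise p σ r)).smul (timeDilationDeriv κ d t))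
    (fun s _ _ => hvI.integrableOn) ?_ ?_
  · rintro _ ⟨B, hB, rfl⟩ -
    exact setIntegral_flowVelocity hp hσ κ t r hB
  · have hm : Measurable[MeasurableSpace.comap (interpolant κ t) inferInstance]
        (interpolant κ t : Vec d × Vec d → Vec d) := comap_measurable _
    have hv := (continuous_flowVelocity hp σ κ r t).measurable.comp hm
    exact hv.stronglyMeasurable.aestronglyMeasurable

/-- The law of `I_t` has full support. -/
lemma eq_of_comp_interpolant_ae_eq (hp : p ∈ Icc (0 : ℝ) 1) (hσ : 0 < σ) (κ t : ℝ) (r : Vec d)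
    {f g : Vec d → Vec d} (hf : Continuous f) (hg : Continuous g)
    (h : (fun ω => f (interpolant κ t ω)) =ᵐ[noiseDataLaw p σ r]
      fun ω => g (interpolant κ t ω)) : f = g := by
  have hIc := continuous_interpolant (d := d) κ t
  obtain ⟨r', hr'⟩ : ∃ r' : Vec d, ∀ᵐ ω ∂((stdGaussian (Vec d)).prod (stdGaussian (Vec d))).map
      (modePair σ r'), f (interpolant κ t ω) = g (interpolant κ t ω) := by
    rw [noiseDataLaw_eq, Filter.EventuallyEq, ae_add_measure_iff] at h
    rcases hp.1.eq_or_lt with h0 | h0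
    · refine ⟨-r, (Measure.ae_ennreal_smul_measure_iff ?_).1 h.2⟩
      simp [← h0]
    · refine ⟨r, (Measure.ae_ennreal_smul_measure_iff ?_).1 h.1⟩
      simpa using h0
  have h2 := ae_of_ae_map (continuous_modePair _ _).aemeasurable hr'
  have h3 : (fun q => f (interpolant κ t (modePair σ r' q))) =
      fun q => g (interpolant κ t (modePair σ r' q)) := by
    have hc := continuous_modePair σ r'
    exact Continuous.ae_eq_iff_eq _ (hf.comp (hIc.comp hc)) (hg.comp (hIc.comp hc)) |>.1 h2
  funext x
  -- `x` is a value of the interpolant along the chosen mode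
  obtain ⟨q, hq⟩ : ∃ q, interpolant κ t (modePair σ r' q) = x := by
    simp only [interpolant, modePair]
    set τ := timeDilation κ d t
    rcases eq_or_ne τ 0 with h0 | h0
    · exact ⟨(x, 0), by simp [h0]⟩
    · refine ⟨(0, σ⁻¹ • (τ⁻¹ • x - r')), ?_⟩
      simp only [smul_zero, zero_add]
      rw [smul_inv_smul₀ hσ.ne', add_sub_cancel, smul_inv_smul₀ h0]
  rw [← hq]
  exact congrFun h3 q

theorem IsProbabilityFlowVelocity.eq_flowVelocity (hp : p ∈ Icc (0 : ℝ) 1) (hσ : 0 < σ) {κ : ℝ}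
    {r : Vec d} {b : ℝ → Vec d → Vec d} (hb : IsProbabilityFlowVelocity p σ κ r b) {t : ℝ}
    (ht : t ∈ Ico (0 : ℝ) 1) : b t = flowVelocity p σ κ r t :=
  eq_of_comp_interpolant_ae_eq hp hσ κ t r (hb t ht).1 (continuous_flowVelocity hp σ κ r t)
    ((hb t ht).2.trans (flowVelocity_ae_eq_condExp hp hσ κ t r).symm)

end velocity

/-! ### Decomposition of the Euler scheme along and across the mode direction -/

section decomposition

variable {d : ℕ} {p σ κ : ℝ}

/-- The factor by which one Euler step multiplies the component orthogonal to `r`. -/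
noncomputable def orthogonalFactor (σ κ : ℝ) (d N j : ℕ) : ℝ :=
  1 + 1 / (N : ℝ) * (timeDilationDeriv κ d (j / N) * linearCoeff σ (timeDilation κ d (j / N)))

/-- The scalar, time-dependent velocity field of the rescaled overlap `⟪r, X⟫ / √d`. -/
noncomputable def overlapVelocity (p σ κ : ℝ) (d : ℕ) (t m : ℝ) : ℝ :=
  timeDilationDeriv κ d t * (linearCoeff σ (timeDilation κ d t) * m +
    modeCoeff σ (timeDilation κ d t) * √(d : ℝ) *
      posteriorSign p (timeDilation κ d t * √(d : ℝ) * m / modeVar σ (timeDilation κ d t)))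

lemma eulerState_congr {V : Type*} [AddCommGroup V] [Module ℝ V] {b c : ℝ → V → V}
    (h : ∀ t ∈ Ico (0 : ℝ) 1, b t = c t) {N k : ℕ} (hk : k ≤ N) (x : V) :
    eulerState b N x k = eulerState c N x k := by
  induction k with
  | zero => rfl
  | succ k ih =>
    have hN : (0 : ℝ) < N := by exact_mod_cast (Nat.succ_pos k).trans_le hk
    have hkN : (k : ℝ) < N := by exact_mod_cast hk
    rw [eulerState, eulerState, ih (by omega), h _ ⟨by positivity, (div_lt_one hN).2 hkN⟩]

lemma continuous_eulerState {V : Type*} [AddCommGroup V] [Module ℝ V] [TopologicalSpace V]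
    [IsTopologicalAddGroup V] [ContinuousSMul ℝ V] {b : ℝ → V → V} (hb : ∀ t, Continuous (b t))
    (N k : ℕ) : Continuous fun x => eulerState b N x k := by
  induction k with
  | zero => exact continuous_id
  | succ k ih => exact ih.add (((hb _).comp ih).const_smul _)

lemma floor_mul_le {t : ℝ} (ht : t ∈ Icc (0 : ℝ) 1) (N : ℕ) : ⌊t * N⌋₊ ≤ N := by
  have : t * N ≤ N := mul_le_of_le_one_left (Nat.cast_nonneg N) ht.2
  exact_mod_cast (Nat.floor_le (by have := ht.1; positivity)).trans this

lemma IsProbabilityFlowVelocity.discretizedFlow_eq (hp : p ∈ Icc (0 : ℝ) 1) (hσ : 0 < σ)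
    {r : Vec d} {b : ℝ → Vec d → Vec d} (hb : IsProbabilityFlowVelocity p σ κ r b) (N : ℕ) {t : ℝ}
    (ht : t ∈ Icc (0 : ℝ) 1) (x : Vec d) :
    discretizedFlow b N t x = eulerState (flowVelocity p σ κ r) N x ⌊t * N⌋₊ :=
  eulerState_congr (fun _ hs => hb.eq_flowVelocity hp hσ hs) (floor_mul_le ht N) x

lemma eulerState_flowVelocity_orthogonal {r : Vec d} (hd : 1 ≤ d) (hr : ‖r‖ ^ 2 = d) (N : ℕ)
    (x : Vec d) (k : ℕ) :
    eulerState (flowVelocity p σ κ r) N x k -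
        (⟪r, eulerState (flowVelocity p σ κ r) N x k⟫ / (d : ℝ)) • r =
      (∏ j ∈ Finset.range k, orthogonalFactor σ κ d N j) • (x - (⟪r, x⟫ / (d : ℝ)) • r) := by
  have hd' : (d : ℝ) ≠ 0 := by positivity
  induction k with
  | zero => simp [eulerState]
  | succ k ih =>
    rw [Finset.prod_range_succ, mul_comm, mul_smul, ← ih, eulerState, flowVelocity,
      conditionalDrift]
    set a := eulerState (flowVelocity p σ κ r) N x k
    simp only [inner_add_right, real_inner_smul_right, real_inner_self_eq_norm_sq, hr,
      orthogonalFactor]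
    match_scalars <;> field_simp
    ring

lemma inner_eulerState_flowVelocity {r : Vec d} (hd : 1 ≤ d) (hr : ‖r‖ ^ 2 = d) (N : ℕ)
    (x : Vec d) (k : ℕ) :
    ⟪r, eulerState (flowVelocity p σ κ r) N x k⟫ / √(d : ℝ) =
      eulerState (overlapVelocity p σ κ d) N (⟪r, x⟫ / √(d : ℝ)) k := by
  have hd' : (0 : ℝ) < d := by positivity
  have hs := Real.sqrt_pos.2 hd'
  have hsq : √(d : ℝ) ^ 2 = d := Real.sq_sqrt hd'.le
  induction k with
  | zero => rfl
  | succ k ih =>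
    rw [eulerState, eulerState, ← ih, flowVelocity, conditionalDrift, overlapVelocity]
    set a := eulerState (flowVelocity p σ κ r) N x k
    simp only [inner_add_right, real_inner_smul_right, real_inner_self_eq_norm_sq, hr, smul_eq_mul]
    have harg : ∀ u : ℝ, u * √(d : ℝ) * (⟪r, a⟫ / √(d : ℝ)) = u * ⟪r, a⟫ := by
      intro u; field_simp
    rw [harg]
    nth_rw 1 [← hsq]
    field_simp

/-- The orthogonal projection of a standard Gaussian vector is standard Gaussian. -/
lemma map_orthogonalProjection_stdGaussian (W : Submodule ℝ (Vec d)) :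
    (stdGaussian (Vec d)).map W.orthogonalProjectionOnto = stdGaussian W := by
  have : IsProbabilityMeasure ((stdGaussian (Vec d)).map W.orthogonalProjectionOnto) :=
    Measure.isProbabilityMeasure_map (by fun_prop)
  refine Measure.ext_of_charFun (funext fun t => ?_)
  rw [charFun_apply, integral_map (by fun_prop) (Measurable.aestronglyMeasurable (by fun_prop)),
    charFun_stdGaussian]
  have h : ∀ x : Vec d, ⟪W.orthogonalProjectionOnto x, t⟫ = ⟪x, (t : Vec d)⟫ := fun x => by simp
  simp_rw [h]
  rw [← charFun_apply, charFun_stdGaussian]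
  rfl

lemma map_smul_abs_stdGaussian {E F : Type*} [NormedAddCommGroup E] [InnerProductSpace ℝ E]
    [FiniteDimensional ℝ E] [MeasurableSpace E] [BorelSpace E] [NormedAddCommGroup F]
    [NormedSpace ℝ F] [MeasurableSpace F] [BorelSpace F] (f : E →L[ℝ] F) (c : ℝ) :
    (stdGaussian E).map (fun w => c • f w) = (stdGaussian E).map (fun w => |c| • f w) := by
  rcases abs_choice c with h | h
  · rw [h]
  · have hneg := stdGaussian_map (LinearIsometryEquiv.neg ℝ (E := E))
    have hm : Measurable fun w : E => |c| • f w :=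
      (f.continuous.const_smul |c|).measurable
    conv_rhs => rw [← hneg, Measure.map_map hm (LinearIsometryEquiv.continuous _).measurable]
    congr 1
    funext w
    simp [h]

lemma map_orthogonal_component {r : Vec d} (hr : ‖r‖ ^ 2 = d) (c : ℝ) :
    (stdGaussian (Vec d)).map (fun x => c • (x - (⟪r, x⟫ / (d : ℝ)) • r)) =
      (stdGaussian ((ℝ ∙ r)ᗮ : Submodule ℝ (Vec d))).map
        (fun w : ((ℝ ∙ r)ᗮ : Submodule ℝ (Vec d)) => |c| • (w : Vec d)) := by
  have h1 : (fun x : Vec d => c • (x - (⟪r, x⟫ / (d : ℝ)) • r)) =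
      (fun w : ((ℝ ∙ r)ᗮ : Submodule ℝ (Vec d)) => c • (w : Vec d)) ∘
        (ℝ ∙ r)ᗮ.orthogonalProjectionOnto := by
    funext x
    have h2 := Submodule.starProjection_singleton ℝ (v := r) x
    simp only [Function.comp_apply, ← Submodule.starProjection_apply,
      Submodule.starProjection_orthogonal_val]
    rw [h2]
    simp [hr]
  rw [h1, ← Measure.map_map (by fun_prop) (by fun_prop), map_orthogonalProjection_stdGaussian]
  exact map_smul_abs_stdGaussian ((ℝ ∙ r)ᗮ : Submodule ℝ (Vec d)).subtypeL c

lemma map_overlap_stdGaussian {r : Vec d} (hd : 1 ≤ d) (hr : ‖r‖ ^ 2 = d) :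
    (stdGaussian (Vec d)).map (fun x => ⟪r, x⟫ / √(d : ℝ)) = gaussianReal 0 1 := by
  have hd' : (0 : ℝ) < d := by positivity
  have : IsProbabilityMeasure ((stdGaussian (Vec d)).map (fun x => ⟪r, x⟫ / √(d : ℝ))) :=
    Measure.isProbabilityMeasure_map (by fun_prop)
  refine Measure.ext_of_charFun (funext fun t => ?_)
  rw [charFun_apply_real, integral_map (by fun_prop)
    (Measurable.aestronglyMeasurable (by fun_prop)), charFun_gaussianReal]
  have h : ∀ x : Vec d, (t : ℂ) * ((⟪r, x⟫ / √(d : ℝ) : ℝ) : ℂ) * Complex.I =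
      (⟪x, (t / √(d : ℝ)) • r⟫ : ℝ) * Complex.I := by
    intro x
    rw [real_inner_smul_right, real_inner_comm]
    push_cast
    ring
  simp_rw [h]
  rw [← charFun_apply, charFun_stdGaussian]
  congr 1
  have h2 : ‖(t / √(d : ℝ)) • r‖ ^ 2 = t ^ 2 := by
    rw [norm_smul, mul_pow, hr, Real.norm_eq_abs, sq_abs, div_pow, Real.sq_sqrt hd'.le]
    field_simp
  rw [← Complex.ofReal_pow, h2]
  push_cast
  ring

end decomposition

/-! ### Convergence of the Euler scheme -/

section euler

/-- A discrete Grönwall inequality for a recursion that holds on a finite range of indices. -/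
lemma le_of_forall_succ_le_one_add_mul_add {e : ℕ → ℝ} {c δ : ℝ} (hc : 0 ≤ c) (hδ : 0 ≤ δ) {i k : ℕ} (hik : i ≤ k)
    (h : ∀ j, i ≤ j → j < k → e (j + 1) ≤ (1 + c) * e j + δ) :
    e k ≤ (e i + (k - i : ℕ) * δ) * (1 + c) ^ (k - i) := by
  induction k, hik using Nat.le_induction with
  | base => simp
  | succ k hik ih =>
    have h1 := ih fun j hj hjk => h j hj (by omega)
    have h2 := h k hik (Nat.lt_succ_self k)
    rw [Nat.succ_sub hik]
    have h3 : (1 : ℝ) ≤ (1 + c) ^ (k - i + 1) := one_le_pow₀ (by linarith)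
    calc e (k + 1) ≤ (1 + c) * ((e i + (k - i : ℕ) * δ) * (1 + c) ^ (k - i)) + δ := by
          have := mul_le_mul_of_nonneg_left h1 (by linarith : 0 ≤ 1 + c)
          linarith
      _ = (e i + (k - i : ℕ) * δ) * (1 + c) ^ (k - i + 1) + δ * 1 := by ring
      _ ≤ (e i + (k - i : ℕ) * δ) * (1 + c) ^ (k - i + 1) + δ * (1 + c) ^ (k - i + 1) := by
          gcongr
      _ = (e i + ((k - i + 1 : ℕ) : ℝ) * δ) * (1 + c) ^ (k - i + 1) := by push_cast; ring

lemma one_add_pow_le_exp {c : ℝ} (hc : 0 ≤ c) (n : ℕ) : (1 + c) ^ n ≤ Real.exp (n * c) := by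
  rw [Real.exp_nat_mul]
  exact pow_le_pow_left₀ (by linarith) (by linarith [Real.add_one_le_exp c]) n

/-- A `C¹` function is approximated by its tangents, uniformly on a compact interval. -/
lemma exists_uniform_tangent {a b : ℝ} {μ g : ℝ → ℝ}
    (hμ : ∀ t ∈ Icc a b, HasDerivWithinAt μ (g t) (Icc a b) t) (hg : ContinuousOn g (Icc a b))
    {η : ℝ} (hη : 0 < η) : ∃ δ > 0, ∀ s ∈ Icc a b, ∀ t ∈ Icc a b, s ≤ t → t - s < δ →
      |μ t - μ s - (t - s) * g s| ≤ η * (t - s) := by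
  obtain ⟨δ, hδ, hunif⟩ := Metric.uniformContinuousOn_iff.1
    (isCompact_Icc.uniformContinuousOn_of_continuous hg) η hη
  refine ⟨δ, hδ, fun s hs t ht hst hlt => ?_⟩
  have hsub : Icc s t ⊆ Icc a b := Icc_subset_Icc hs.1 ht.2
  have h := Convex.norm_image_sub_le_of_norm_hasDerivWithin_le (s := Icc s t) (C := η)
    (f := fun u => μ u - u * g s) (f' := fun u => g u - 1 * g s) (x := s) (y := t)
    (fun u hu => ((hμ u (hsub hu)).mono hsub).sub ((hasDerivWithinAt_id u _).mul_const (g s)))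
    (fun u hu => ?_) (convex_Icc s t) (left_mem_Icc.2 hst) (right_mem_Icc.2 hst)
  · rw [Real.norm_eq_abs, Real.norm_eq_abs, abs_of_nonneg (sub_nonneg.2 hst)] at h
    convert h using 2
    ring
  · rw [one_mul]
    refine (hunif u (hsub hu) s hs ?_).le
    rw [Real.dist_eq, abs_of_nonneg (by linarith [hu.1])]
    linarith [hu.2]

/-- **Convergence of the explicit Euler scheme** for a scalar differential equation with a `C¹`
solution and a field that is Lipschitz in space. The scheme runs from the grid index `i N` to the
grid index `k N`. -/
theorem tendsto_euler_sub {a b K : ℝ} {f : ℝ → ℝ → ℝ} {μ : ℝ → ℝ} (hK : 0 ≤ K)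
    (hμ : ∀ t ∈ Icc a b, HasDerivWithinAt μ (f t (μ t)) (Icc a b) t)
    (hc : ContinuousOn (fun t => f t (μ t)) (Icc a b))
    (hf : ∀ t ∈ Icc a b, ∀ x y, |f t x - f t y| ≤ K * |x - y|)
    {y : ℕ → ℕ → ℝ} {i k : ℕ → ℕ}
    (hi : ∀ᶠ N : ℕ in atTop, a ≤ (i N : ℝ) / N)
    (hik : ∀ᶠ N in atTop, i N ≤ k N) (hk : ∀ᶠ N : ℕ in atTop, (k N : ℝ) / N ≤ b)
    (hy : ∀ᶠ N in atTop, ∀ j, i N ≤ j → j < k N →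
      y N (j + 1) = y N j + 1 / (N : ℝ) * f (j / N) (y N j))
    (h0 : Tendsto (fun N => y N (i N) - μ (i N / N)) atTop (𝓝 0)) :
    Tendsto (fun N => y N (k N) - μ (k N / N)) atTop (𝓝 0) := by
  rw [Metric.tendsto_nhds]
  intro ε hε
  set C := Real.exp (K * (b - a)) with hC
  have hCpos : 0 < C := Real.exp_pos _
  set η := ε / (4 * C * (1 + |b - a|)) with hη
  have hη0 : 0 < η := by positivity
  obtain ⟨δ, hδ, htan⟩ := exists_uniform_tangent hμ hc hη0
  have hN0 : Tendsto (fun N : ℕ => 1 / (N : ℝ)) atTop (𝓝 0) := tendsto_one_div_atTop_nhds_zero_nat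
  filter_upwards [hi, hik, hk, hy, hN0.eventually (gt_mem_nhds hδ), eventually_gt_atTop 0,
    (Metric.tendsto_nhds.1 h0) (ε / (4 * C)) (by positivity)] with N hi hik hk hy hNδ hN h0
  have hNpos : (0 : ℝ) < N := by exact_mod_cast hN
  rw [Real.dist_eq, sub_zero] at h0 ⊢
  have hgrid : ∀ j, i N ≤ j → j ≤ k N → (j : ℝ) / N ∈ Icc a b := by
    intro j h1 h2
    constructor
    · refine hi.trans ?_
      gcongr
    · refine le_trans ?_ hk
      gcongr
  have hgr := le_of_forall_succ_le_one_add_mul_add (e := fun j => |y N j - μ (j / N)|) (c := K / N) (δ := η / N)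
    (by positivity) (by positivity) hik fun j hj hjk => by
      have hj1 := hgrid j hj hjk.le
      have hj2 := hgrid (j + 1) (by omega) hjk
      have hstep : ((j + 1 : ℕ) : ℝ) / N - (j : ℝ) / N = 1 / N := by push_cast; ring
      have ht := htan _ hj1 _ hj2 (by linarith [show 0 ≤ 1 / (N : ℝ) by positivity])
        (by rwa [hstep])
      rw [hstep] at ht
      have hl := hf _ hj1 (y N j) (μ (j / N))
      rw [hy j hj hjk]
      have h1 : y N j + 1 / (N : ℝ) * f (j / N) (y N j) - μ ((j + 1 : ℕ) / N) =
          (y N j - μ (j / N)) + 1 / (N : ℝ) * (f (j / N) (y N j) - f (j / N) (μ (j / N))) -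
          (μ ((j + 1 : ℕ) / N) - μ (j / N) - 1 / N * f (j / N) (μ (j / N))) := by ring
      rw [h1]
      refine (abs_sub _ _).trans ((add_le_add (abs_add_le _ _) ht).trans ?_)
      rw [abs_mul, abs_of_pos (by positivity : (0 : ℝ) < 1 / N)]
      have h2 : 1 / (N : ℝ) * |f (j / N) (y N j) - f (j / N) (μ (j / N))| ≤
          1 / (N : ℝ) * (K * |y N j - μ (j / N)|) := by gcongr
      calc _ ≤ |y N j - μ (j / N)| + 1 / (N : ℝ) * (K * |y N j - μ (j / N)|) + η * (1 / N) := by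
            gcongr
        _ = _ := by ring
  have hlen : ((k N - i N : ℕ) : ℝ) / N ≤ b - a := by
    rw [Nat.cast_sub hik, sub_div]
    linarith
  have hexp : (1 + K / N) ^ (k N - i N) ≤ C := by
    refine (one_add_pow_le_exp (by positivity) _).trans (Real.exp_le_exp.2 ?_)
    calc ((k N - i N : ℕ) : ℝ) * (K / N) = K * (((k N - i N : ℕ) : ℝ) / N) := by ring
      _ ≤ K * (b - a) := by gcongr
  have hlen2 : ((k N - i N : ℕ) : ℝ) * (η / N) ≤ (1 + |b - a|) * η := by
    calc ((k N - i N : ℕ) : ℝ) * (η / N) = ((k N - i N : ℕ) : ℝ) / N * η := by ring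
      _ ≤ (1 + |b - a|) * η := by
        gcongr
        linarith [le_abs_self (b - a)]
  calc |y N (k N) - μ (k N / N)|
      ≤ (|y N (i N) - μ (i N / N)| + ((k N - i N : ℕ) : ℝ) * (η / N)) *
          (1 + K / N) ^ (k N - i N) := hgr
    _ ≤ (ε / (4 * C) + (1 + |b - a|) * η) * C := by
        gcongr
    _ = ε / 2 := by
        rw [hη]
        field_simp
        ring
    _ < ε := by linarith

lemma tendsto_floor_mul_div (t : ℝ) (ht : 0 ≤ t) :
    Tendsto (fun N : ℕ => (⌊t * N⌋₊ : ℝ) / N) atTop (𝓝 t) :=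
  (tendsto_nat_floor_mul_div_atTop ht).comp tendsto_natCast_atTop_atTop

end euler

/-! ### The high-dimensional limit of the coefficients -/

section coefficients

variable {σ κ : ℝ}

lemma continuous_modeVar (σ : ℝ) : Continuous (modeVar σ) := by
  unfold modeVar
  fun_prop

lemma continuous_linearCoeff (hσ : 0 < σ) : Continuous (linearCoeff σ) := by
  unfold linearCoeff
  exact Continuous.div (by fun_prop) (continuous_modeVar σ) fun τ => (modeVar_pos hσ τ).ne'

lemma continuous_modeCoeff (hσ : 0 < σ) : Continuous (modeCoeff σ) := by
  unfold modeCoeff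
  exact Continuous.div (by fun_prop) (continuous_modeVar σ) fun τ => (modeVar_pos hσ τ).ne'

lemma tendsto_const_div_sqrt (c : ℝ) : Tendsto (fun d : ℕ => c / √(d : ℝ)) atTop (𝓝 0) :=
  tendsto_const_nhds.div_atTop
    (Real.tendsto_sqrt_atTop.comp tendsto_natCast_atTop_atTop)

lemma tendsto_timeDilation_of_le {t : ℝ} (ht : t ≤ 1 / 2) :
    Tendsto (fun d => timeDilation κ d t) atTop (𝓝 0) := by
  simp only [timeDilation, if_pos ht]
  exact tendsto_const_div_sqrt _

lemma tendsto_timeDilation_of_ge {t : ℝ} (ht : 1 / 2 ≤ t) :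
    Tendsto (fun d => timeDilation κ d t) atTop (𝓝 (2 * t - 1)) := by
  rcases ht.eq_or_lt with rfl | h
  · simpa using tendsto_timeDilation_of_le (κ := κ) le_rfl
  · simp only [timeDilation, if_neg (not_le.2 h)]
    have h0 := tendsto_const_div_sqrt κ
    simpa using h0.add ((h0.const_sub 1).mul_const (2 * t - 1))

lemma tendsto_timeDilationDeriv_of_lt {t : ℝ} (ht : t < 1 / 2) :
    Tendsto (fun d => timeDilationDeriv κ d t) atTop (𝓝 0) := by
  simp only [timeDilationDeriv, if_pos ht]
  exact tendsto_const_div_sqrt _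

lemma tendsto_timeDilationDeriv_of_ge {t : ℝ} (ht : 1 / 2 ≤ t) :
    Tendsto (fun d => timeDilationDeriv κ d t) atTop (𝓝 2) := by
  simp only [timeDilationDeriv, if_neg (not_lt.2 ht)]
  simpa using ((tendsto_const_div_sqrt κ).const_sub 1).const_mul 2

end coefficients

/-! ### The orthogonal component -/

section orthogonal

variable {σ κ : ℝ}

/-- The limit of `orthogonalFactor` as the dimension grows. -/
noncomputable def orthogonalFactorLimit (σ : ℝ) (N j : ℕ) : ℝ :=
  if (j : ℝ) / N < 1 / 2 then 1
  else 1 + 1 / (N : ℝ) * (2 * linearCoeff σ (2 * (j / N) - 1))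

lemma tendsto_orthogonalFactor (hσ : 0 < σ) (N j : ℕ) :
    Tendsto (fun d => orthogonalFactor σ κ d N j) atTop (𝓝 (orthogonalFactorLimit σ N j)) := by
  unfold orthogonalFactor orthogonalFactorLimit
  have hc := continuous_linearCoeff hσ
  split_ifs with h
  · simpa using (((tendsto_timeDilationDeriv_of_lt h).mul
      ((hc.tendsto _).comp (tendsto_timeDilation_of_le (κ := κ) h.le))).const_mul
        (1 / (N : ℝ))).const_add 1
  · have h' := not_lt.1 h
    exact (((tendsto_timeDilationDeriv_of_ge h').mul
      ((hc.tendsto _).comp (tendsto_timeDilation_of_ge (κ := κ) h'))).const_mul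
        (1 / (N : ℝ))).const_add 1

lemma prod_orthogonalFactorLimit_eq_one {N k : ℕ} (h : (k : ℝ) / N ≤ 1 / 2) :
    ∏ j ∈ Finset.range k, orthogonalFactorLimit σ N j = 1 := by
  refine Finset.prod_eq_one fun j hj => if_pos ?_
  have hjk : j < k := Finset.mem_range.1 hj
  rcases Nat.eq_zero_or_pos N with rfl | hN
  · simp
  · exact lt_of_lt_of_le (by gcongr) h

lemma hasDerivAt_sqrt_modeVar (hσ : 0 < σ) (t : ℝ) :
    HasDerivAt (fun t => √(modeVar σ (2 * t - 1)))
      (2 * linearCoeff σ (2 * t - 1) * √(modeVar σ (2 * t - 1))) t := by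
  have hV := modeVar_pos hσ (2 * t - 1)
  have hs := Real.sqrt_pos.2 hV
  have hsq : √(modeVar σ (2 * t - 1)) ^ 2 = modeVar σ (2 * t - 1) := Real.sq_sqrt hV.le
  have h1 : HasDerivAt (fun t : ℝ => 2 * t - 1) 2 t := by
    simpa using ((hasDerivAt_id t).const_mul 2).sub_const 1
  have h2 : HasDerivAt (fun t : ℝ => modeVar σ (2 * t - 1))
      (4 * ((2 * t - 1) * σ ^ 2 - (1 - (2 * t - 1)))) t := by
    unfold modeVar
    exact (((h1.const_sub 1).pow 2).add ((h1.mul_const σ).pow 2)).congr_deriv (by ring)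
  refine (h2.sqrt hV.ne').congr_deriv ?_
  rw [linearCoeff]
  nth_rw 2 [← hsq]
  field_simp
  ring

lemma tendsto_prod_orthogonalFactorLimit (hσ : 0 < σ) {t : ℝ} (ht : t ∈ Icc (1 / 2 : ℝ) 1) :
    Tendsto (fun N : ℕ => ∏ j ∈ Finset.range ⌊t * N⌋₊, orthogonalFactorLimit σ N j) atTop
      (𝓝 √(modeVar σ (2 * t - 1))) := by
  have hfloor := tendsto_floor_mul_div t (by linarith [ht.1])
  have hcont : Continuous fun t => √(modeVar σ (2 * t - 1)) :=
    continuous_iff_continuousAt.2 fun t => (hasDerivAt_sqrt_modeVar hσ t).continuousAt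
  have hcl := continuous_linearCoeff hσ
  rcases ht.1.eq_or_lt with h | h
  · have hlim : √(modeVar σ (2 * t - 1)) = 1 := by simp [← h, modeVar]
    rw [hlim]
    refine tendsto_const_nhds.congr fun N => (prod_orthogonalFactorLimit_eq_one ?_).symm
    rw [h]
    exact div_le_of_le_mul₀ (Nat.cast_nonneg N) (by linarith [ht.1])
      (Nat.floor_le (by have := ht.1; positivity))
  obtain ⟨K, hK⟩ := isCompact_Icc.exists_bound_of_continuousOn (s := Icc (1 / 2 : ℝ) 1)
    (f := fun t => 2 * linearCoeff σ (2 * t - 1)) (by fun_prop)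
  have hK0 : 0 ≤ K := (norm_nonneg _).trans (hK 1 (by norm_num))
  have hceil : Tendsto (fun N : ℕ => (⌈(1 / 2 : ℝ) * N⌉₊ : ℝ) / N) atTop (𝓝 (1 / 2)) :=
    (tendsto_nat_ceil_mul_div_atTop (by norm_num)).comp tendsto_natCast_atTop_atTop
  have hle : ∀ᶠ N : ℕ in atTop, ⌈(1 / 2 : ℝ) * N⌉₊ ≤ ⌊t * N⌋₊ := by
    filter_upwards [hceil.eventually_lt hfloor h, eventually_gt_atTop 0] with N hN hN0
    have hNpos : (0 : ℝ) < N := by exact_mod_cast hN0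
    exact_mod_cast ((div_lt_div_iff_of_pos_right hNpos).1 hN).le
  have key := tendsto_euler_sub (a := 1 / 2) (b := 1) (f := fun t x => 2 * linearCoeff σ (2 * t - 1) * x)
    (μ := fun t => √(modeVar σ (2 * t - 1)))
    (y := fun N k => ∏ j ∈ Finset.range k, orthogonalFactorLimit σ N j)
    (i := fun N => ⌈(1 / 2 : ℝ) * N⌉₊) (k := fun N => ⌊t * N⌋₊) hK0
    (fun s _ => (hasDerivAt_sqrt_modeVar hσ s).hasDerivWithinAt) (by fun_prop)
    (fun s hs x y => ?_) ?_ hle ?_ ?_ ?_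
  · simpa using key.add ((hcont.tendsto t).comp hfloor)
  · rw [← mul_sub, abs_mul]
    exact mul_le_mul_of_nonneg_right (hK s hs) (abs_nonneg _)
  · filter_upwards [eventually_gt_atTop 0] with N hN0
    have hNpos : (0 : ℝ) < N := by exact_mod_cast hN0
    rw [le_div_iff₀ hNpos]
    exact Nat.le_ceil _
  · filter_upwards [eventually_gt_atTop 0] with N hN0
    have hNpos : (0 : ℝ) < N := by exact_mod_cast hN0
    rw [div_le_one hNpos]
    exact_mod_cast floor_mul_le ⟨by linarith [ht.1], ht.2⟩ N
  · filter_upwards [eventually_gt_atTop 0] with N hN0 j hj _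
    have hNpos : (0 : ℝ) < N := by exact_mod_cast hN0
    have hj' : ¬ (j : ℝ) / N < 1 / 2 := by
      rw [not_lt, le_div_iff₀ hNpos]
      exact (Nat.le_ceil _).trans (by exact_mod_cast hj)
    rw [Finset.prod_range_succ, orthogonalFactorLimit, if_neg hj']
    ring
  · have h1 : ∀ N : ℕ, ∏ j ∈ Finset.range ⌈(1 / 2 : ℝ) * N⌉₊, orthogonalFactorLimit σ N j = 1 := by
      intro N
      refine Finset.prod_eq_one fun j hj => if_pos ?_
      have hj' := Nat.lt_ceil.1 (Finset.mem_range.1 hj)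
      have hNpos : (0 : ℝ) < N := by
        have : (0 : ℝ) ≤ j := Nat.cast_nonneg j
        linarith
      rwa [div_lt_iff₀ hNpos]
    simp only [h1]
    have h2 := ((hcont.tendsto (1 / 2)).comp hceil).const_sub 1
    simpa [modeVar] using h2

/-- The scale of the orthogonal component after the Euler steps up to time `t`. -/
noncomputable def orthogonalScale (σ κ : ℝ) (N d : ℕ) (t : ℝ) : ℝ :=
  |∏ j ∈ Finset.range ⌊t * N⌋₊, orthogonalFactor σ κ d N j|

lemma tendsto_orthogonalScale (hσ : 0 < σ) (N : ℕ) (t : ℝ) :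
    Tendsto (fun d => orthogonalScale σ κ N d t) atTop
      (𝓝 |∏ j ∈ Finset.range ⌊t * N⌋₊, orthogonalFactorLimit σ N j|) :=
  (tendsto_finsetProd _ fun j _ => tendsto_orthogonalFactor hσ N j).abs

lemma hasIteratedLimit_orthogonalScale_first (hσ : 0 < σ) {t : ℝ}
    (ht : t ∈ Icc (0 : ℝ) (1 / 2)) :
    HasIteratedLimit (fun N d => orthogonalScale σ κ N d t) 1 := by
  refine ⟨fun N => 1, Eventually.of_forall fun N => ?_, tendsto_const_nhds⟩
  have h := tendsto_orthogonalScale (κ := κ) hσ N t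
  rw [prod_orthogonalFactorLimit_eq_one, abs_one] at h
  · exact h
  · exact div_le_of_le_mul₀ (Nat.cast_nonneg N) (by norm_num)
      ((Nat.floor_le (by have := ht.1; positivity)).trans
        (mul_le_mul_of_nonneg_right ht.2 (Nat.cast_nonneg N)))

lemma hasIteratedLimit_orthogonalScale_second (hσ : 0 < σ) {t : ℝ}
    (ht : t ∈ Icc (1 / 2 : ℝ) 1) :
    HasIteratedLimit (fun N d => orthogonalScale σ κ N d t)
      √((2 - 2 * t) ^ 2 + (2 * t - 1) ^ 2 * σ ^ 2) := by
  refine ⟨_, Eventually.of_forall fun N => tendsto_orthogonalScale hσ N t, ?_⟩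
  have h := (tendsto_prod_orthogonalFactorLimit hσ ht).abs
  rw [abs_of_nonneg (Real.sqrt_nonneg _)] at h
  convert h using 3
  rw [modeVar]
  ring

end orthogonal

/-! ### The first phase -/

section firstPhase

variable {p σ κ : ℝ}

/-- The limit of `overlapVelocity` in the first phase as the dimension grows. -/
noncomputable def overlapVelocityLimit (p κ t y : ℝ) : ℝ := 2 * κ * posteriorSign p (2 * κ * t * y)

lemma timeDilation_mul_sqrt {d : ℕ} (hd : 1 ≤ d) {t : ℝ} (ht : t ≤ 1 / 2) :
    timeDilation κ d t * √(d : ℝ) = 2 * κ * t := by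
  have : √(d : ℝ) ≠ 0 := (Real.sqrt_pos.2 (by exact_mod_cast hd)).ne'
  rw [timeDilation, if_pos ht, div_mul_cancel₀ _ this]

lemma timeDilationDeriv_mul_sqrt {d : ℕ} (hd : 1 ≤ d) {t : ℝ} (ht : t < 1 / 2) :
    timeDilationDeriv κ d t * √(d : ℝ) = 2 * κ := by
  have : √(d : ℝ) ≠ 0 := (Real.sqrt_pos.2 (by exact_mod_cast hd)).ne'
  rw [timeDilationDeriv, if_pos ht, div_mul_cancel₀ _ this]

lemma continuous_overlapVelocity (hp : p ∈ Icc (0 : ℝ) 1) (d : ℕ) (t : ℝ) :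
    Continuous (overlapVelocity p σ κ d t) := by
  have := continuous_posteriorSign hp
  unfold overlapVelocity
  fun_prop

lemma continuous_overlapVelocityLimit (hp : p ∈ Icc (0 : ℝ) 1) (t : ℝ) :
    Continuous (overlapVelocityLimit p κ t) := by
  have := continuous_posteriorSign hp
  unfold overlapVelocityLimit
  fun_prop

lemma tendsto_posteriorSign_first (hp : p ∈ Icc (0 : ℝ) 1) {t : ℝ} (ht : t ≤ 1 / 2)
    {m : ℕ → ℝ} {y : ℝ} (hm : Tendsto m atTop (𝓝 y)) :
    Tendsto (fun d : ℕ => posteriorSign p (timeDilation κ d t * √(d : ℝ) * m d /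
      modeVar σ (timeDilation κ d t))) atTop (𝓝 (posteriorSign p (2 * κ * t * y))) := by
  have hτ := tendsto_timeDilation_of_le (κ := κ) ht
  have hV : Tendsto (fun d => modeVar σ (timeDilation κ d t)) atTop (𝓝 1) := by
    have h0 : modeVar σ 0 = 1 := by simp [modeVar]
    exact h0 ▸ ((continuous_modeVar σ).tendsto 0).comp hτ
  have h1 : Tendsto (fun d => 2 * κ * t * m d / modeVar σ (timeDilation κ d t)) atTop
      (𝓝 (2 * κ * t * y / 1)) := (hm.const_mul _).div hV one_ne_zero
  rw [div_one] at h1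
  refine (((continuous_posteriorSign hp).tendsto _).comp h1).congr' ?_
  filter_upwards [eventually_ge_atTop 1] with d hd
  rw [Function.comp_apply, timeDilation_mul_sqrt hd ht]

lemma tendsto_overlapVelocity_first (hp : p ∈ Icc (0 : ℝ) 1) (hσ : 0 < σ) {t : ℝ} (ht : t < 1 / 2)
    {m : ℕ → ℝ} {y : ℝ} (hm : Tendsto m atTop (𝓝 y)) :
    Tendsto (fun d => overlapVelocity p σ κ d t (m d)) atTop
      (𝓝 (overlapVelocityLimit p κ t y)) := by
  have hτ := tendsto_timeDilation_of_le (κ := κ) ht.le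
  have hmode : Tendsto (fun d => modeCoeff σ (timeDilation κ d t)) atTop (𝓝 1) := by
    have h0 : modeCoeff σ 0 = 1 := by simp [modeCoeff, modeVar]
    exact h0 ▸ ((continuous_modeCoeff hσ).tendsto 0).comp hτ
  have hlin := ((continuous_linearCoeff hσ).tendsto 0).comp hτ
  have h := ((tendsto_timeDilationDeriv_of_lt (κ := κ) ht).mul (hlin.mul hm)).add
    ((hmode.const_mul (2 * κ)).mul (tendsto_posteriorSign_first (σ := σ) (κ := κ) hp ht.le hm))
  simp only [zero_mul, zero_add, mul_one] at h
  refine h.congr' ?_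
  filter_upwards [eventually_ge_atTop 1] with d hd
  rw [overlapVelocity, ← timeDilationDeriv_mul_sqrt hd ht]
  simp only [Function.comp_apply]
  ring

lemma tendsto_eulerState_overlapVelocity_first (hp : p ∈ Icc (0 : ℝ) 1) (hσ : 0 < σ) (N : ℕ)
    (g : ℝ) {k : ℕ} (hk : ∀ j < k, (j : ℝ) / N < 1 / 2) :
    Tendsto (fun d => eulerState (overlapVelocity p σ κ d) N g k) atTop
      (𝓝 (eulerState (overlapVelocityLimit p κ) N g k)) := by
  induction k with
  | zero => exact tendsto_const_nhds
  | succ k ih =>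
    have h := ih fun j hj => hk j (by omega)
    exact h.add ((tendsto_overlapVelocity_first hp hσ (hk k (Nat.lt_succ_self k)) h).const_smul _)

lemma abs_overlapVelocityLimit_le (hp : p ∈ Icc (0 : ℝ) 1) (hκ : 0 < κ) (t y : ℝ) :
    |overlapVelocityLimit p κ t y| ≤ 2 * κ := by
  rw [overlapVelocityLimit, abs_mul, abs_of_pos (by positivity : 0 < 2 * κ)]
  exact mul_le_of_le_one_right (by positivity) (abs_posteriorSign_le hp _)

lemma abs_overlapVelocityLimit_sub_le (hp : p ∈ Icc (0 : ℝ) 1) (hκ : 0 < κ) {t : ℝ}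
    (ht : t ∈ Icc (0 : ℝ) (1 / 2)) (x y : ℝ) :
    |overlapVelocityLimit p κ t x - overlapVelocityLimit p κ t y| ≤ 2 * κ ^ 2 * |x - y| := by
  rw [overlapVelocityLimit, overlapVelocityLimit, ← mul_sub, abs_mul,
    abs_of_pos (by positivity : 0 < 2 * κ)]
  have h := abs_posteriorSign_sub_le hp (2 * κ * t * x) (2 * κ * t * y)
  rw [← mul_sub, abs_mul, abs_of_nonneg (mul_nonneg (by positivity) ht.1 : 0 ≤ 2 * κ * t)] at h
  calc 2 * κ * |posteriorSign p (2 * κ * t * x) - posteriorSign p (2 * κ * t * y)|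
      ≤ 2 * κ * (2 * κ * t * |x - y|) := by gcongr
    _ ≤ 2 * κ * (2 * κ * (1 / 2) * |x - y|) := by gcongr; exact ht.2
    _ = 2 * κ ^ 2 * |x - y| := by ring

/-- `μ` is the flow on `[0, 1/2]` of the limiting overlap velocity: `μ t g` is the position at time
`t` of the solution started from `g`. -/
structure IsOverlapFlow (p κ : ℝ) (μ : ℝ → ℝ → ℝ) : Prop where
  start : ∀ g, μ 0 g = g
  hasDeriv : ∀ g, ∀ t ∈ Icc (0 : ℝ) (1 / 2),
    HasDerivWithinAt (fun u => μ u g) (overlapVelocityLimit p κ t (μ t g)) (Icc 0 (1 / 2)) t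

lemma exists_isOverlapFlow (hp : p ∈ Icc (0 : ℝ) 1) (hκ : 0 < κ) :
    ∃ μ, IsOverlapFlow p κ μ := by
  have h : ∀ g : ℝ, ∃ α : ℝ → ℝ, α 0 = g ∧ ∀ t ∈ Icc (0 : ℝ) (1 / 2),
      HasDerivWithinAt α (overlapVelocityLimit p κ t (α t)) (Icc 0 (1 / 2)) t := by
    intro g
    -- the field is bounded by `2κ`, so a trajectory moves by at most `κ`
    have hPL : IsPicardLindelof (overlapVelocityLimit p κ) (tmin := 0) (tmax := 1 / 2)
        ⟨0, by norm_num⟩ g ⟨κ, hκ.le⟩ 0 ⟨2 * κ, by positivity⟩ ⟨2 * κ ^ 2, by positivity⟩ := by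
      constructor
      · intro t ht
        refine LipschitzWith.lipschitzOnWith (LipschitzWith.of_dist_le_mul fun x y => ?_)
        rw [Real.dist_eq, Real.dist_eq]
        exact abs_overlapVelocityLimit_sub_le hp hκ ht x y
      · intro x _
        have := continuous_posteriorSign hp
        unfold overlapVelocityLimit
        fun_prop
      · intro t _ x _
        exact abs_overlapVelocityLimit_le hp hκ t x
      · change 2 * κ * max ((1 : ℝ) / 2 - 0) (0 - 0) ≤ κ - 0
        rw [max_eq_left (by norm_num)]
        linarith
    exact hPL.exists_eq_forall_mem_Icc_hasDerivWithinAt₀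
  choose α h0 hα using h
  exact ⟨fun t g => α g t, h0, hα⟩

namespace IsOverlapFlow

variable {μ : ℝ → ℝ → ℝ}

lemma tendsto_eulerState (hp : p ∈ Icc (0 : ℝ) 1) (hκ : 0 < κ) (hμ : IsOverlapFlow p κ μ) {t : ℝ}
    (ht : t ∈ Icc (0 : ℝ) (1 / 2)) (g : ℝ) :
    Tendsto (fun N : ℕ => eulerState (overlapVelocityLimit p κ) N g ⌊t * N⌋₊) atTop
      (𝓝 (μ t g)) := by
  have hcont : ContinuousOn (fun u => μ u g) (Icc 0 (1 / 2)) := fun u hu =>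
    (hμ.hasDeriv g u hu).continuousWithinAt
  have hle : ∀ N : ℕ, (⌊t * N⌋₊ : ℝ) / N ≤ t := fun N =>
    div_le_of_le_mul₀ (Nat.cast_nonneg N) ht.1
      (Nat.floor_le (mul_nonneg ht.1 (Nat.cast_nonneg N)))
  have key := tendsto_euler_sub (a := 0) (b := 1 / 2) (K := 2 * κ ^ 2)
    (f := overlapVelocityLimit p κ) (μ := fun u => μ u g)
    (y := fun N k => eulerState (overlapVelocityLimit p κ) N g k)
    (i := fun N => 0) (k := fun N => ⌊t * N⌋₊) (by positivity) (hμ.hasDeriv g) ?_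
    (fun s hs x y => abs_overlapVelocityLimit_sub_le hp hκ hs x y)
    (Eventually.of_forall fun N => by simp) (Eventually.of_forall fun N => Nat.zero_le _)
    (Eventually.of_forall fun N => (hle N).trans ht.2)
    (Eventually.of_forall fun N j _ _ => rfl) ?_
  · have h1 : Tendsto (fun N : ℕ => μ ((⌊t * N⌋₊ : ℝ) / N) g) atTop (𝓝 (μ t g)) := by
      refine Tendsto.comp (y := 𝓝[Icc 0 (1 / 2)] t) (hcont t ht) ?_
      refine tendsto_nhdsWithin_iff.2 ⟨tendsto_floor_mul_div t ht.1, Eventually.of_forall fun N => ?_⟩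
      exact ⟨by positivity, (hle N).trans ht.2⟩
    simpa using key.add h1
  · have := continuous_posteriorSign hp
    unfold overlapVelocityLimit
    fun_prop
  · simp [eulerState, hμ.start]

lemma measurable (hp : p ∈ Icc (0 : ℝ) 1) (hκ : 0 < κ) (hμ : IsOverlapFlow p κ μ) {t : ℝ}
    (ht : t ∈ Icc (0 : ℝ) (1 / 2)) : Measurable (μ t) := by
  refine measurable_of_tendsto_metrizable (f := fun N : ℕ => fun g =>
    eulerState (overlapVelocityLimit p κ) N g ⌊t * N⌋₊) (fun N => ?_)
    (tendsto_pi_nhds.2 fun g => hμ.tendsto_eulerState hp hκ ht g)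
  exact (continuous_eulerState (continuous_overlapVelocityLimit hp) _ _).measurable

end IsOverlapFlow

/-! ### The law of the flow at the end of the first phase -/

/-- The standard Gaussian distribution function, normalized to vanish at `0`. -/
noncomputable def gaussianPrimitive (x : ℝ) : ℝ := ∫ y in (0 : ℝ)..x, gaussianPDFReal 0 1 y

lemma continuous_gaussianPDFReal : Continuous (gaussianPDFReal 0 1) := by
  unfold gaussianPDFReal
  fun_prop

lemma hasDerivAt_gaussianPrimitive (x : ℝ) :
    HasDerivAt gaussianPrimitive (gaussianPDFReal 0 1 x) x :=
  intervalIntegral.integral_hasDerivAt_right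
    (continuous_gaussianPDFReal.intervalIntegrable _ _)
    (continuous_gaussianPDFReal.stronglyMeasurableAtFilter _ _)
    continuous_gaussianPDFReal.continuousAt

lemma continuous_gaussianPrimitive : Continuous gaussianPrimitive :=
  continuous_iff_continuousAt.2 fun x => (hasDerivAt_gaussianPrimitive x).continuousAt

lemma strictMono_gaussianPrimitive : StrictMono gaussianPrimitive :=
  strictMono_of_deriv_pos fun x => by
    rw [(hasDerivAt_gaussianPrimitive x).deriv]
    exact gaussianPDFReal_pos 0 1 x one_ne_zero

lemma gaussianReal_real_Iic (m x : ℝ) : (gaussianReal m 1).real (Iic x) =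
    (gaussianReal 0 1).real (Iic 0) + gaussianPrimitive (x - m) := by
  have h1 : gaussianReal m 1 = (gaussianReal 0 1).map (· + m) := by
    rw [gaussianReal_map_add_const, zero_add]
  have h2 : (· + m) ⁻¹' Iic x = Iic (x - m) := by
    ext y
    simp [le_sub_iff_add_le]
  have h3 : ∀ z, (gaussianReal 0 1).real (Iic z) = ∫ y in Iic z, gaussianPDFReal 0 1 y := by
    intro z
    rw [measureReal_def, gaussianReal_apply_eq_integral _ one_ne_zero, ENNReal.toReal_ofReal]
    exact integral_nonneg fun y => gaussianPDFReal_nonneg _ _ _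
  rw [h1, map_measureReal_apply (by fun_prop) measurableSet_Iic, h2, h3, h3, gaussianPrimitive,
    ← intervalIntegral.integral_Iic_sub_Iic
      (integrable_gaussianPDFReal 0 1).integrableOn (integrable_gaussianPDFReal 0 1).integrableOn]
  ring

lemma isProbabilityMeasure_gaussianMixtureReal (hp : p ∈ Icc (0 : ℝ) 1) (m : ℝ) :
    IsProbabilityMeasure (gaussianMixtureReal p m) := by
  constructor
  rw [gaussianMixtureReal]
  simp only [Measure.add_apply, Measure.smul_apply, measure_univ, smul_eq_mul, mul_one]
  rw [← ENNReal.ofReal_add hp.1 (by linarith [hp.2])]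
  simp

lemma gaussianMixtureReal_real (hp : p ∈ Icc (0 : ℝ) 1) (m : ℝ) (s : Set ℝ) :
    (gaussianMixtureReal p m).real s =
      p * (gaussianReal m 1).real s + (1 - p) * (gaussianReal (-m) 1).real s := by
  have h : ∀ c m' : ℝ, (ENNReal.ofReal c • gaussianReal m' 1) s ≠ ⊤ := fun c m' =>
    ENNReal.mul_ne_top ENNReal.ofReal_ne_top (measure_ne_top _ _)
  rw [gaussianMixtureReal, measureReal_add_apply (h _ _) (h _ _),
    measureReal_ennreal_smul_apply, measureReal_ennreal_smul_apply, ENNReal.toReal_ofReal hp.1,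
    ENNReal.toReal_ofReal (by linarith [hp.2])]

/-- The distribution function of `p N(m, 1) + (1 - p) N(-m, 1)`, up to an additive constant. -/
noncomputable def mixturePrimitive (p m x : ℝ) : ℝ :=
  p * gaussianPrimitive (x - m) + (1 - p) * gaussianPrimitive (x + m)

lemma strictMono_mixturePrimitive (hp : p ∈ Icc (0 : ℝ) 1) (m : ℝ) :
    StrictMono (mixturePrimitive p m) := by
  intro x y hxy
  have h1 := strictMono_gaussianPrimitive (show x - m < y - m by linarith)
  have h2 := strictMono_gaussianPrimitive (show x + m < y + m by linarith)
  unfold mixturePrimitive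
  rcases hp.1.eq_or_lt with h0 | h0
  · simpa [← h0] using h2
  · have h3 := mul_lt_mul_of_pos_left h1 h0
    have h4 := mul_le_mul_of_nonneg_left h2.le (by linarith [hp.2] : 0 ≤ 1 - p)
    linarith

lemma gaussianPDFReal_shift (x m : ℝ) : gaussianPDFReal 0 1 (x - m) =
    gaussianPDFReal 0 1 x * Real.exp (-(m ^ 2 / 2)) * Real.exp (m * x) := by
  simp only [gaussianPDFReal]
  rw [mul_assoc _ (Real.exp _), mul_assoc _ (Real.exp _), ← Real.exp_add, ← Real.exp_add]
  congr 2
  push_cast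
  ring

/-- The velocity times the density of the mixture `p N(m, 1) + (1 - p) N(-m, 1)` is the flux of its
components, which move in opposite directions. This is the integrated continuity equation. -/
lemma posteriorSign_mul_mixture_density (hp : p ∈ Icc (0 : ℝ) 1) (m x : ℝ) :
    posteriorSign p (m * x) *
        (p * gaussianPDFReal 0 1 (x - m) + (1 - p) * gaussianPDFReal 0 1 (x + m)) =
      p * gaussianPDFReal 0 1 (x - m) - (1 - p) * gaussianPDFReal 0 1 (x + m) := by
  have h1 := gaussianPDFReal_shift x m
  have h2 := gaussianPDFReal_shift x (-m)
  rw [sub_neg_eq_add, neg_sq, neg_mul] at h2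
  have hN : posteriorSign p (m * x) *
      (p * Real.exp (m * x) + (1 - p) * Real.exp (-(m * x))) =
      p * Real.exp (m * x) - (1 - p) * Real.exp (-(m * x)) :=
    div_mul_cancel₀ _ (posteriorSign_denom_pos hp _).ne'
  rw [h1, h2]
  linear_combination (gaussianPDFReal 0 1 x * Real.exp (-(m ^ 2 / 2))) * hN

namespace IsOverlapFlow

variable {μ : ℝ → ℝ → ℝ}

/-- The distribution function of the moving mixture is constant along trajectories. -/
lemma mixturePrimitive_eq (hp : p ∈ Icc (0 : ℝ) 1) (hμ : IsOverlapFlow p κ μ) (g : ℝ) :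
    mixturePrimitive p κ (μ (1 / 2) g) = gaussianPrimitive g := by
  have hder : ∀ t ∈ Icc (0 : ℝ) (1 / 2), HasDerivWithinAt
      (fun u => mixturePrimitive p (2 * κ * u) (μ u g)) 0 (Icc 0 (1 / 2)) t := by
    intro t ht
    have h1 := hμ.hasDeriv g t ht
    have h2 : HasDerivWithinAt (fun u : ℝ => 2 * κ * u) (2 * κ) (Icc 0 (1 / 2)) t := by
      simpa using (hasDerivWithinAt_id t (Icc 0 (1 / 2))).const_mul (2 * κ)
    have h3 := (((hasDerivAt_gaussianPrimitive _).comp_hasDerivWithinAt t (h1.sub h2)).const_mul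
      p).add (((hasDerivAt_gaussianPrimitive _).comp_hasDerivWithinAt t (h1.add h2)).const_mul
      (1 - p))
    refine h3.congr_deriv ?_
    have key := posteriorSign_mul_mixture_density hp (2 * κ * t) (μ t g)
    simp only [Pi.sub_apply, Pi.add_apply, overlapVelocityLimit]
    linear_combination (2 * κ) * key
  have h := Convex.norm_image_sub_le_of_norm_hasDerivWithin_le (C := 0) hder (fun t _ => by simp)
    (convex_Icc _ _) (left_mem_Icc.2 (by norm_num)) (right_mem_Icc.2 (by norm_num))
  rw [zero_mul, norm_le_zero_iff, sub_eq_zero] at h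
  have h2 : 2 * κ * (1 / 2) = κ := by ring
  rw [h2, hμ.start] at h
  rw [h, mixturePrimitive]
  simp only [mul_zero, sub_zero, add_zero]
  ring

lemma injective_half (hp : p ∈ Icc (0 : ℝ) 1) (hμ : IsOverlapFlow p κ μ) :
    Function.Injective (μ (1 / 2)) := fun x y hxy => by
  apply strictMono_gaussianPrimitive.injective
  rw [← hμ.mixturePrimitive_eq hp, ← hμ.mixturePrimitive_eq hp, hxy]

lemma map_half (hp : p ∈ Icc (0 : ℝ) 1) (hκ : 0 < κ) (hμ : IsOverlapFlow p κ μ) :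
    (gaussianReal 0 1).map (μ (1 / 2)) = gaussianMixtureReal p κ := by
  have hmeas := hμ.measurable hp hκ (right_mem_Icc.2 (by norm_num))
  have := isProbabilityMeasure_gaussianMixtureReal hp κ
  have : IsProbabilityMeasure ((gaussianReal 0 1).map (μ (1 / 2))) :=
    Measure.isProbabilityMeasure_map hmeas.aemeasurable
  refine Measure.eq_of_cdf _ _ (StieltjesFunction.ext fun x => ?_)
  rw [cdf_eq_real, cdf_eq_real, map_measureReal_apply hmeas measurableSet_Iic,
    gaussianMixtureReal_real hp, gaussianReal_real_Iic κ, gaussianReal_real_Iic (-κ), sub_neg_eq_add]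
  have hmono := strictMono_gaussianPrimitive.monotone (show x - κ ≤ x + κ by linarith)
  obtain ⟨y, -, hy⟩ := intermediate_value_Icc (show x - κ ≤ x + κ by linarith)
    continuous_gaussianPrimitive.continuousOn
    (show mixturePrimitive p κ x ∈ Icc (gaussianPrimitive (x - κ)) (gaussianPrimitive (x + κ)) by
      unfold mixturePrimitive
      constructor <;> nlinarith [hp.1, hp.2])
  have hset : μ (1 / 2) ⁻¹' Iic x = Iic y := by
    ext g
    rw [mem_preimage, mem_Iic, mem_Iic, ← (strictMono_mixturePrimitive hp κ).le_iff_le,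
      hμ.mixturePrimitive_eq hp, ← hy, strictMono_gaussianPrimitive.le_iff_le]
  rw [hset, gaussianReal_real_Iic 0, sub_zero, hy, mixturePrimitive]
  ring

end IsOverlapFlow

end firstPhase

/-! ### The second phase -/

section secondPhase

variable {p σ κ : ℝ}

/-- The Euler scheme of the second phase in the limit of large dimension, after `j` steps of size
`1 / (2n)` from `t = 1/2`, for the overlap `⟪r, X⟫ / d`. The overlap vanishes at `t = 1/2`, where
the posterior mean of the mode is `s`; from the next step on, that mean is the sign of `s`. -/
noncomputable def signalState (σ : ℝ) (n : ℕ) (s : ℝ) : ℕ → ℝ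
  | 0 => 0
  | j + 1 => signalState σ n s j + 1 / ((2 * n : ℕ) : ℝ) *
      (2 * (linearCoeff σ (2 * (((n + j : ℕ) : ℝ) / (2 * n : ℕ)) - 1) * signalState σ n s j +
        modeCoeff σ (2 * (((n + j : ℕ) : ℝ) / (2 * n : ℕ)) - 1) *
          if j = 0 then s else Real.sign s))

lemma linearCoeff_mul_add_modeCoeff (hσ : 0 < σ) (τ : ℝ) :
    linearCoeff σ τ * τ + modeCoeff σ τ = 1 := by
  have hV := (modeVar_pos hσ τ).ne'
  rw [linearCoeff, modeCoeff, div_mul_eq_mul_div, ← add_div, div_eq_one_iff_eq hV, modeVar]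
  ring

lemma modeCoeff_pos (hσ : 0 < σ) {τ : ℝ} (hτ : τ < 1) : 0 < modeCoeff σ τ :=
  div_pos (by linarith) (modeVar_pos hσ τ)

lemma modeCoeff_zero : modeCoeff σ 0 = 1 := by simp [modeCoeff, modeVar]

lemma grid_start {n : ℕ} (hn : 0 < n) : 2 * (((n : ℕ) : ℝ) / (2 * n : ℕ)) - 1 = 0 := by
  push_cast
  field_simp
  ring

lemma grid_lt {n j : ℕ} (hjn : j < n) : 2 * (((n + j : ℕ) : ℝ) / (2 * n : ℕ)) - 1 < 1 := by
  have hn : (0 : ℝ) < n := by exact_mod_cast (Nat.zero_le j).trans_lt hjn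
  have h : (j : ℝ) < n := by exact_mod_cast hjn
  have : (((n + j : ℕ) : ℝ) / (2 * n : ℕ)) < 1 := by
    push_cast
    rw [div_lt_one (by positivity)]
    linarith
  linarith

lemma grid_mem {n j : ℕ} (hn : 0 < n) (hjn : j ≤ n) :
    2 * (((n + j : ℕ) : ℝ) / (2 * n : ℕ)) - 1 ∈ Icc (0 : ℝ) 1 := by
  have hn' : (0 : ℝ) < n := by exact_mod_cast hn
  have h : (j : ℝ) ≤ n := by exact_mod_cast hjn
  have h2 : 2 * (((n + j : ℕ) : ℝ) / (2 * n : ℕ)) - 1 = j / n := by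
    push_cast
    field_simp
    ring
  rw [h2]
  exact ⟨by positivity, (div_le_one hn').2 h⟩

/-- If the steps are small enough, the sign of the overlap is the one chosen by the first step. -/
lemma sign_mul_signalState_pos (hσ : 0 < σ) {n : ℕ} {s : ℝ} (hs : s ≠ 0)
    (hstep : ∀ τ ∈ Icc (0 : ℝ) 1, 0 ≤ 1 + 1 / ((2 * n : ℕ) : ℝ) * (2 * linearCoeff σ τ))
    {j : ℕ} (hj : 1 ≤ j) (hjn : j ≤ n) : 0 < Real.sign s * signalState σ n s j := by
  induction j, hj using Nat.le_induction with
  | base =>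
    have hN : (0 : ℝ) < (2 * n : ℕ) := by exact_mod_cast (by omega : 0 < 2 * n)
    have hss : 0 < Real.sign s * s := by
      rcases hs.lt_or_gt with h | h
      · rw [Real.sign_of_neg h]; linarith
      · rw [Real.sign_of_pos h]; linarith
    simp only [signalState, add_zero, grid_start (by omega : 0 < n), modeCoeff_zero, if_true]
    calc 0 < 1 / ((2 * n : ℕ) : ℝ) * 2 * (Real.sign s * s) := by positivity
      _ = _ := by ring
  | succ j hj ih =>
    have h1 := ih (by omega)
    have hN : (0 : ℝ) < (2 * n : ℕ) := by exact_mod_cast (by omega : 0 < 2 * n)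
    rw [signalState, if_neg (by omega)]
    have hm := modeCoeff_pos hσ (grid_lt (show j < n by omega))
    have h2 := mul_nonneg (hstep _ (grid_mem (by omega) (show j ≤ n by omega))) h1.le
    generalize 2 * (((n + j : ℕ) : ℝ) / (2 * n : ℕ)) - 1 = τ at *
    have hsq : Real.sign s * Real.sign s = 1 := by
      rcases Real.sign_apply_eq_of_ne_zero s hs with h | h <;> rw [h] <;> norm_num
    have h3 : 0 < 1 / ((2 * n : ℕ) : ℝ) * (2 * modeCoeff σ τ) := by positivity
    linear_combination h2 + h3 - 1 / ((2 * n : ℕ) : ℝ) * (2 * modeCoeff σ τ) * hsq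

/-- Along the exact solution `2t - 1`, which is affine in `t`, the Euler scheme makes no error. The
only error is committed in the first step, where `s` stands in for its sign. -/
lemma abs_signalState_sub_le (hσ : 0 < σ) {n : ℕ} (hn : 0 < n) {s K : ℝ} (hs : |s| ≤ 1)
    (hK : ∀ τ ∈ Icc (0 : ℝ) 1, |2 * linearCoeff σ τ| ≤ K) {j : ℕ} (hjn : j ≤ n) :
    |signalState σ n s j - Real.sign s * (2 * (((n + j : ℕ) : ℝ) / (2 * n : ℕ)) - 1)| ≤
      4 / ((2 * n : ℕ) : ℝ) * Real.exp K := by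
  have hN : (0 : ℝ) < (2 * n : ℕ) := by exact_mod_cast (by omega : 0 < 2 * n)
  have hK0 : 0 ≤ K := (abs_nonneg _).trans (hK 0 (by norm_num))
  have hgrid : ∀ j : ℕ, 2 * (((n + (j + 1) : ℕ) : ℝ) / (2 * n : ℕ)) - 1 =
      (2 * (((n + j : ℕ) : ℝ) / (2 * n : ℕ)) - 1) + 2 * (1 / ((2 * n : ℕ) : ℝ)) := by
    intro j
    push_cast
    ring
  rcases Nat.eq_zero_or_pos j with rfl | hj
  · simp only [signalState, add_zero, grid_start hn]
    simp only [mul_zero, sub_zero, abs_zero]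
    positivity
  have hgr := le_of_forall_succ_le_one_add_mul_add (e := fun j => |signalState σ n s j -
    Real.sign s * (2 * (((n + j : ℕ) : ℝ) / (2 * n : ℕ)) - 1)|) (c := K / (2 * n : ℕ)) (δ := 0)
    (by positivity) le_rfl hj fun i hi hij => by
      rw [hgrid, signalState, if_neg (by omega)]
      have h1 := hK _ (grid_mem hn (show i ≤ n by omega))
      have hid := linearCoeff_mul_add_modeCoeff hσ (2 * (((n + i : ℕ) : ℝ) / (2 * n : ℕ)) - 1)
      generalize 2 * (((n + i : ℕ) : ℝ) / (2 * n : ℕ)) - 1 = τ at *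
      have h2 : signalState σ n s i + 1 / ((2 * n : ℕ) : ℝ) *
          (2 * (linearCoeff σ τ * signalState σ n s i + modeCoeff σ τ * Real.sign s)) -
          Real.sign s * (τ + 2 * (1 / ((2 * n : ℕ) : ℝ))) =
          (1 + 1 / ((2 * n : ℕ) : ℝ) * (2 * linearCoeff σ τ)) *
            (signalState σ n s i - Real.sign s * τ) := by
        linear_combination 1 / ((2 * n : ℕ) : ℝ) * 2 * Real.sign s * hid
      rw [h2, abs_mul, add_zero]
      gcongr
      refine (abs_add_le _ _).trans ?_
      rw [abs_one, abs_mul, abs_of_pos (by positivity : 0 < 1 / ((2 * n : ℕ) : ℝ)), one_div_mul_eq_div]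
      gcongr
  have h1 : |signalState σ n s 1 - Real.sign s * (2 * (((n + 1 : ℕ) : ℝ) / (2 * n : ℕ)) - 1)| ≤
      4 / ((2 * n : ℕ) : ℝ) := by
    have h2 := hgrid 0
    simp only [zero_add, add_zero, grid_start hn] at h2
    rw [h2]
    simp only [signalState, add_zero, grid_start hn, modeCoeff_zero, if_true]
    have h3 : |s - Real.sign s| ≤ 2 := by
      rw [abs_le] at hs ⊢
      rcases Real.sign_apply_eq s with h | h | h <;> rw [h] <;> constructor <;> linarith
    calc |0 + 1 / ((2 * n : ℕ) : ℝ) * (2 * (linearCoeff σ 0 * 0 + 1 * s)) -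
          Real.sign s * (2 * (1 / ((2 * n : ℕ) : ℝ)))|
        = |2 / ((2 * n : ℕ) : ℝ) * (s - Real.sign s)| := by congr 1; ring
      _ = 2 / ((2 * n : ℕ) : ℝ) * |s - Real.sign s| := by
          rw [abs_mul, abs_of_pos (by positivity)]
      _ ≤ 2 / ((2 * n : ℕ) : ℝ) * 2 := by gcongr
      _ = 4 / ((2 * n : ℕ) : ℝ) := by ring
  refine hgr.trans ?_
  simp only [mul_zero, add_zero]
  refine mul_le_mul h1 ?_ (by positivity) (by positivity)
  refine (one_add_pow_le_exp (by positivity) _).trans (Real.exp_le_exp.2 ?_)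
  rw [mul_div_assoc', div_le_iff₀ hN, mul_comm]
  refine mul_le_mul_of_nonneg_left ?_ hK0
  exact_mod_cast (by omega : j - 1 ≤ 2 * n)

lemma tendsto_posteriorSign_saturated (hp : p ∈ Icc (0 : ℝ) 1) {u : ℝ} (hu : posteriorSign p u ≠ 0)
    {a l : ℕ → ℝ} {L : ℝ} (ha : Tendsto a atTop atTop) (hl : Tendsto l atTop (𝓝 L))
    (hL : 0 < Real.sign (posteriorSign p u) * L) :
    Tendsto (fun d => posteriorSign p (a d * l d)) atTop (𝓝 (Real.sign (posteriorSign p u))) := by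
  rcases hu.lt_or_gt with h | h
  · rw [Real.sign_of_neg h] at hL ⊢
    exact (tendsto_posteriorSign_atBot (lt_one_of_posteriorSign_neg hp h)).comp
      (ha.atTop_mul_neg (by linarith) hl)
  · rw [Real.sign_of_pos h] at hL ⊢
    exact (tendsto_posteriorSign_atTop (pos_of_posteriorSign_pos hp h)).comp
      (ha.atTop_mul_pos (by linarith) hl)

lemma tendsto_eulerState_overlapVelocity_second (hp : p ∈ Icc (0 : ℝ) 1) (hσ : 0 < σ) {n : ℕ}
    (hn : 0 < n) (g : ℝ)
    (hstep : ∀ τ ∈ Icc (0 : ℝ) 1, 0 ≤ 1 + 1 / ((2 * n : ℕ) : ℝ) * (2 * linearCoeff σ τ))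
    (hs : posteriorSign p (κ * eulerState (overlapVelocityLimit p κ) (2 * n) g n) ≠ 0)
    {j : ℕ} (hjn : j ≤ n) :
    Tendsto (fun d : ℕ => eulerState (overlapVelocity p σ κ d) (2 * n) g (n + j) / √(d : ℝ)) atTop
      (𝓝 (signalState σ n
        (posteriorSign p (κ * eulerState (overlapVelocityLimit p κ) (2 * n) g n)) j)) := by
  have hN : (0 : ℝ) < (2 * n : ℕ) := by exact_mod_cast (by omega : 0 < 2 * n)
  have hfirst := tendsto_eulerState_overlapVelocity_first (κ := κ) hp hσ (2 * n) g (k := n)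
    fun j hj => by
      have : (j : ℝ) < n := by exact_mod_cast hj
      rw [div_lt_iff₀ hN]
      push_cast
      linarith
  have hsqrt : Tendsto (fun d : ℕ => √(d : ℝ)) atTop atTop :=
    Real.tendsto_sqrt_atTop.comp tendsto_natCast_atTop_atTop
  induction j with
  | zero => exact hfirst.div_atTop hsqrt
  | succ j ih =>
    have h := ih (by omega)
    have hmem := grid_mem hn (show j ≤ n by omega)
    have ht : (1 : ℝ) / 2 ≤ ((n + j : ℕ) : ℝ) / (2 * n : ℕ) := by linarith [hmem.1]
    have hτ := tendsto_timeDilation_of_ge (κ := κ) ht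
    have hlin := ((continuous_linearCoeff hσ).tendsto _).comp hτ
    have hmode := ((continuous_modeCoeff hσ).tendsto _).comp hτ
    set s := posteriorSign p (κ * eulerState (overlapVelocityLimit p κ) (2 * n) g n) with hs_def
    have hpost : Tendsto (fun d : ℕ => posteriorSign p (timeDilation κ d (((n + j : ℕ) : ℝ) /
        (2 * n : ℕ)) * √(d : ℝ) * eulerState (overlapVelocity p σ κ d) (2 * n) g (n + j) /
        modeVar σ (timeDilation κ d (((n + j : ℕ) : ℝ) / (2 * n : ℕ))))) atTop
        (𝓝 (if j = 0 then s else Real.sign s)) := by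
      split_ifs with hj
      · subst hj
        have h2 : ((n + 0 : ℕ) : ℝ) / (2 * n : ℕ) = 1 / 2 := by
          have := grid_start hn
          rw [add_zero]
          linarith
        rw [h2]
        have h3 := tendsto_posteriorSign_first (σ := σ) (κ := κ) hp le_rfl hfirst
        rwa [show 2 * κ * (1 / 2 : ℝ) = κ by ring] at h3
      · -- the argument of the posterior mean grows like `d` times the overlap
        have hτpos : 0 < 2 * (((n + j : ℕ) : ℝ) / (2 * n : ℕ)) - 1 := by
          have hj' : (0 : ℝ) < j := by exact_mod_cast Nat.pos_of_ne_zero hj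
          have hn' : (0 : ℝ) < n := by exact_mod_cast hn
          have : 2 * (((n + j : ℕ) : ℝ) / (2 * n : ℕ)) - 1 = j / n := by
            push_cast
            field_simp
            ring
          rw [this]
          positivity
        have hV := ((continuous_modeVar σ).tendsto _).comp hτ
        have hq : Tendsto (fun d => timeDilation κ d (((n + j : ℕ) : ℝ) / (2 * n : ℕ)) /
            modeVar σ (timeDilation κ d (((n + j : ℕ) : ℝ) / (2 * n : ℕ)))) atTop _ :=
          hτ.div hV (modeVar_pos hσ _).ne'
        have ha := (tendsto_natCast_atTop_atTop (R := ℝ)).atTop_mul_pos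
          (div_pos hτpos (modeVar_pos hσ _)) hq
        refine (tendsto_posteriorSign_saturated hp hs ha h
          (sign_mul_signalState_pos hσ hs hstep (by omega) (by omega))).congr' ?_
        filter_upwards [eventually_ge_atTop 1] with d hd
        have hd' : (0 : ℝ) < d := by exact_mod_cast hd
        have hsq : √(d : ℝ) * √(d : ℝ) = d := Real.mul_self_sqrt hd'.le
        have hsp := Real.sqrt_pos.2 hd'
        congr 1
        nth_rw 1 [← hsq]
        field_simp
    have hall := h.add (((tendsto_timeDilationDeriv_of_ge (κ := κ) ht).mul
      ((hlin.mul h).add (hmode.mul hpost))).const_mul (1 / ((2 * n : ℕ) : ℝ)))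
    refine hall.congr' ?_
    filter_upwards [eventually_ge_atTop 1] with d hd
    have hsp : √(d : ℝ) ≠ 0 := (Real.sqrt_pos.2 (by exact_mod_cast hd)).ne'
    rw [← add_assoc n j 1, eulerState, overlapVelocity]
    simp only [Function.comp_apply, smul_eq_mul]
    field_simp

lemma strictMono_eulerState_overlapVelocityLimit (hp : p ∈ Icc (0 : ℝ) 1) (hκ : 0 < κ) (N k : ℕ) :
    StrictMono fun g => eulerState (overlapVelocityLimit p κ) N g k := by
  induction k with
  | zero => exact strictMono_id
  | succ k ih =>
    intro x y hxy
    have h1 := ih hxy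
    simp only [eulerState, smul_eq_mul] at h1 ⊢
    refine add_lt_add_of_lt_of_le h1 ?_
    generalize eulerState (overlapVelocityLimit p κ) N x k = a at h1 ⊢
    generalize eulerState (overlapVelocityLimit p κ) N y k = c at h1 ⊢
    have h2 : posteriorSign p (2 * κ * (k / N) * a) ≤ posteriorSign p (2 * κ * (k / N) * c) :=
      monotone_posteriorSign hp (by gcongr)
    unfold overlapVelocityLimit
    gcongr

lemma ae_posteriorSign_ne_zero (hp : p ∈ Icc (0 : ℝ) 1) (hκ : 0 < κ) {f : ℝ → ℝ}
    (hf : Function.Injective f) : ∀ᵐ g ∂gaussianReal 0 1, posteriorSign p (κ * f g) ≠ 0 := by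
  have : NullSingletonClass (gaussianReal 0 1) := nullSingletonClass_gaussianReal one_ne_zero
  refine Set.Subsingleton.measure_zero (fun x hx y hy => hf ?_) _
  simp only [ne_eq, not_not, mem_compl_iff, mem_ofPred_eq] at hx hy
  exact mul_left_cancel₀ hκ.ne' (eq_of_posteriorSign_eq_zero hp hx hy)

lemma measurable_signalState (σ : ℝ) (n j : ℕ) : Measurable fun s => signalState σ n s j := by
  have hsign : Measurable Real.sign := by
    unfold Real.sign
    exact Measurable.ite measurableSet_Iio measurable_const
      (Measurable.ite measurableSet_Ioi measurable_const measurable_const)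
  induction j with
  | zero => exact measurable_const
  | succ j ih =>
    simp only [signalState]
    split_ifs <;> fun_prop

end secondPhase

/-! ### Convergence in distribution -/

section distribution

/-- If random vectors in growing dimension depend on the Gaussian vector only through the overlap
`⟪r, x⟫ / √d`, which is standard Gaussian, then iterated almost sure convergence of the functions of
the overlap gives iterated convergence in distribution. -/
lemma hasIteratedLimitInDistribution_of_overlap {m : ℕ} {r : (d : ℕ) → Vec d}
    (hr : ∀ d, ‖r d‖ ^ 2 = (d : ℝ)) {X : ℕ → (d : ℕ) → Vec d → Fin m → ℝ}
    {G : ℕ → ℕ → ℝ → Fin m → ℝ} {H : ℕ → ℝ → Fin m → ℝ} {Z : ℝ → Fin m → ℝ}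
    (hX : ∀ N d, Measurable (X N d))
    (hXG : ∀ N d, 1 ≤ d → ∀ x, X N d x = G N d (⟪r d, x⟫ / √(d : ℝ)))
    (hG : ∀ N d, Measurable (G N d)) (hH : ∀ N, Measurable (H N))
    (hGH : ∀ᶠ N in atTop, ∀ᵐ g ∂gaussianReal 0 1, Tendsto (fun d => G N d g) atTop (𝓝 (H N g)))
    (hHZ : ∀ᵐ g ∂gaussianReal 0 1, Tendsto (fun N => H N g) atTop (𝓝 (Z g))) :
    HasIteratedLimitInDistribution X Z (gaussianReal 0 1) := by
  have hZ : AEMeasurable Z (gaussianReal 0 1) :=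
    aemeasurable_of_tendsto_metrizable_ae atTop (fun N => (hH N).aemeasurable) hHZ
  obtain ⟨ρ, hρ⟩ : ∃ ρ : ℕ → ProbabilityMeasure (Fin m → ℝ),
      ∀ N, (ρ N : Measure (Fin m → ℝ)) = (gaussianReal 0 1).map (H N) :=
    ⟨fun N => ⟨(gaussianReal 0 1).map (H N),
      Measure.isProbabilityMeasure_map (hH N).aemeasurable⟩, fun N => rfl⟩
  refine ⟨ρ, ?_, ?_⟩
  · filter_upwards [hGH] with N hN
    have base := tendstoInDistribution_of_ae_tendsto (fun d => (hG N d).aemeasurable)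
      (hH N).aemeasurable hN
    refine ⟨fun d => (hX N d).aemeasurable, aemeasurable_id, ?_⟩
    have hlim : (⟨(ρ N : Measure (Fin m → ℝ)).map id, Measure.isProbabilityMeasure_map
        aemeasurable_id⟩ : ProbabilityMeasure (Fin m → ℝ)) = ⟨(gaussianReal 0 1).map (H N),
          Measure.isProbabilityMeasure_map base.aemeasurable_limit⟩ :=
      Subtype.ext (Measure.map_id.trans (hρ N))
    rw [hlim]
    refine base.tendsto.congr' ?_
    filter_upwards [eventually_ge_atTop 1] with d hd
    refine Subtype.ext ?_
    change (gaussianReal 0 1).map (G N d) = (stdGaussian (Vec d)).map (X N d)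
    rw [funext (hXG N d hd), ← map_overlap_stdGaussian hd (hr d),
      Measure.map_map (hG N d) (by fun_prop)]
    rfl
  · have base := tendstoInDistribution_of_ae_tendsto (fun N => (hH N).aemeasurable) hZ hHZ
    refine ⟨fun N => aemeasurable_id, hZ, ?_⟩
    refine base.tendsto.congr fun N => Subtype.ext ?_
    exact (hρ N).symm.trans Measure.map_id.symm

variable {p σ κ : ℝ}

lemma IsProbabilityFlowVelocity.continuous_discretizedFlow {d : ℕ} (hp : p ∈ Icc (0 : ℝ) 1)
    (hσ : 0 < σ) {r : Vec d} {b : ℝ → Vec d → Vec d} (hb : IsProbabilityFlowVelocity p σ κ r b)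
    (N : ℕ) {t : ℝ} (ht : t ∈ Icc (0 : ℝ) 1) : Continuous (discretizedFlow b N t) := by
  rw [funext (hb.discretizedFlow_eq hp hσ N ht)]
  exact continuous_eulerState (continuous_flowVelocity hp σ κ r) _ _

lemma IsProbabilityFlowVelocity.overlap_discretizedFlow {d : ℕ} (hp : p ∈ Icc (0 : ℝ) 1)
    (hσ : 0 < σ) (hd : 1 ≤ d) {r : Vec d} (hr : ‖r‖ ^ 2 = (d : ℝ)) {b : ℝ → Vec d → Vec d}
    (hb : IsProbabilityFlowVelocity p σ κ r b) (N : ℕ) {t : ℝ} (ht : t ∈ Icc (0 : ℝ) 1)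
    (x : Vec d) : ⟪r, discretizedFlow b N t x⟫ / √(d : ℝ) =
      eulerState (overlapVelocity p σ κ d) N (⟪r, x⟫ / √(d : ℝ)) ⌊t * N⌋₊ := by
  rw [hb.discretizedFlow_eq hp hσ N ht, inner_eulerState_flowVelocity hd hr]

lemma IsOverlapFlow.processHasIteratedLimit (hp : p ∈ Icc (0 : ℝ) 1) (hσ : 0 < σ) (hκ : 0 < κ)
    {μ : ℝ → ℝ → ℝ} (hμ : IsOverlapFlow p κ μ) {r : (d : ℕ) → Vec d}
    (hr : ∀ d, ‖r d‖ ^ 2 = (d : ℝ)) {b : (d : ℕ) → ℝ → Vec d → Vec d}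
    (hb : ∀ d, IsProbabilityFlowVelocity p σ κ (r d) (b d)) :
    ProcessHasIteratedLimit (Icc 0 (1 / 2))
      (fun N d t x => ⟪r d, discretizedFlow (b d) N t x⟫ / √(d : ℝ)) μ (gaussianReal 0 1) := by
  intro m t ht
  have ht1 : ∀ i, t i ∈ Icc (0 : ℝ) 1 := fun i => ⟨(ht i).1, by linarith [(ht i).2]⟩
  refine hasIteratedLimitInDistribution_of_overlap hr
    (G := fun N d g i => eulerState (overlapVelocity p σ κ d) N g ⌊t i * N⌋₊)
    (H := fun N g i => eulerState (overlapVelocityLimit p κ) N g ⌊t i * N⌋₊) ?_ ?_ ?_ ?_ ?_ ?_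
  · intro N d
    refine measurable_pi_lambda _ fun i => Continuous.measurable ?_
    have := (hb d).continuous_discretizedFlow hp hσ N (ht1 i)
    fun_prop
  · intro N d hd x
    funext i
    exact (hb d).overlap_discretizedFlow hp hσ hd (hr d) N (ht1 i) x
  · intro N d
    exact measurable_pi_lambda _ fun i =>
      (continuous_eulerState (continuous_overlapVelocity hp d) _ _).measurable
  · intro N
    exact measurable_pi_lambda _ fun i =>
      (continuous_eulerState (continuous_overlapVelocityLimit hp) _ _).measurable
  · filter_upwards [eventually_gt_atTop 0] with N hN
    refine ae_of_all _ fun g => tendsto_pi_nhds.2 fun i => ?_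
    refine tendsto_eulerState_overlapVelocity_first hp hσ N g fun j hj => ?_
    have hNpos : (0 : ℝ) < N := by exact_mod_cast hN
    have h1 : ((j + 1 : ℕ) : ℝ) ≤ t i * N :=
      (Nat.le_floor_iff (mul_nonneg (ht i).1 hNpos.le)).1 hj
    rw [div_lt_iff₀ hNpos]
    have h2 := mul_le_mul_of_nonneg_right (ht i).2 hNpos.le
    push_cast at h1
    linarith
  · exact ae_of_all _ fun g => tendsto_pi_nhds.2 fun i => hμ.tendsto_eulerState hp hκ (ht i) g

/-- The mode selected at the beginning of the second phase, as a function of the position `y` of the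
overlap at the end of the first phase. On the null set where the posterior is balanced it is set to
`-1`. -/
noncomputable def selectedMode (p κ y : ℝ) : ℝ := if 0 < posteriorSign p (κ * y) then 1 else -1

lemma selectedMode_eq_or (p κ y : ℝ) : selectedMode p κ y = 1 ∨ selectedMode p κ y = -1 := by
  unfold selectedMode
  split_ifs <;> simp

lemma sign_posteriorSign {y : ℝ} (h : posteriorSign p (κ * y) ≠ 0) :
    Real.sign (posteriorSign p (κ * y)) = selectedMode p κ y := by
  unfold selectedMode
  split_ifs with h1
  · exact Real.sign_of_pos h1
  · exact Real.sign_of_neg (lt_of_le_of_ne (not_lt.1 h1) h)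

lemma IsOverlapFlow.tendsto_eulerState_half (hp : p ∈ Icc (0 : ℝ) 1) (hκ : 0 < κ)
    {μ : ℝ → ℝ → ℝ} (hμ : IsOverlapFlow p κ μ) (g : ℝ) :
    Tendsto (fun n : ℕ => eulerState (overlapVelocityLimit p κ) (2 * n) g n) atTop
      (𝓝 (μ (1 / 2) g)) := by
  have h := (hμ.tendsto_eulerState hp hκ (right_mem_Icc.2 (by norm_num)) g).comp
    (tendsto_id.const_mul_atTop' (two_pos) : Tendsto (fun n : ℕ => 2 * n) atTop atTop)
  refine h.congr fun n => ?_
  have : (1 / 2 : ℝ) * ((2 * n : ℕ) : ℝ) = n := by push_cast; ring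
  simp only [Function.comp_apply]
  rw [this, Nat.floor_natCast]

lemma floor_second_phase {t : ℝ} (ht : t ∈ Icc (1 / 2 : ℝ) 1) (n : ℕ) :
    ∃ j ≤ n, ⌊t * (2 * n : ℕ)⌋₊ = n + j := by
  have h1 : n ≤ ⌊t * (2 * n : ℕ)⌋₊ := by
    refine Nat.le_floor ?_
    push_cast
    nlinarith [ht.1, Nat.cast_nonneg (α := ℝ) n]
  have h2 := floor_mul_le ⟨by linarith [ht.1], ht.2⟩ (2 * n)
  exact ⟨⌊t * (2 * n : ℕ)⌋₊ - n, by omega, by omega⟩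

lemma tendsto_signalState (hσ : 0 < σ) {t : ℝ} (ht : t ∈ Icc (1 / 2 : ℝ) 1) {s : ℕ → ℝ} {S : ℝ}
    (hs : Tendsto s atTop (𝓝 S)) (hS : S ≠ 0) (hs1 : ∀ n, |s n| ≤ 1) :
    Tendsto (fun n : ℕ => signalState σ n (s n) (⌊t * (2 * n : ℕ)⌋₊ - n)) atTop
      (𝓝 ((2 * t - 1) * Real.sign S)) := by
  obtain ⟨K, hK⟩ := isCompact_Icc.exists_bound_of_continuousOn (s := Icc (0 : ℝ) 1)
    (f := fun τ => 2 * linearCoeff σ τ) (by have := continuous_linearCoeff hσ; fun_prop)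
  have hdouble : Tendsto (fun n : ℕ => 2 * n) atTop atTop :=
    tendsto_id.const_mul_atTop' two_pos
  have hfloor := (tendsto_floor_mul_div t (by linarith [ht.1])).comp hdouble
  have hsign : ∀ᶠ n in atTop, Real.sign (s n) = Real.sign S := by
    rcases hS.lt_or_gt with h | h
    · filter_upwards [hs.eventually (gt_mem_nhds h)] with n hn
      rw [Real.sign_of_neg h, Real.sign_of_neg hn]
    · filter_upwards [hs.eventually (lt_mem_nhds h)] with n hn
      rw [Real.sign_of_pos h, Real.sign_of_pos hn]
  have herr : Tendsto (fun n : ℕ => 4 / ((2 * n : ℕ) : ℝ) * Real.exp K) atTop (𝓝 0) := by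
    have := ((tendsto_const_div_atTop_nhds_zero_nat (4 : ℝ)).comp hdouble).mul_const (Real.exp K)
    rwa [zero_mul] at this
  have hdiff : Tendsto (fun n : ℕ => signalState σ n (s n) (⌊t * (2 * n : ℕ)⌋₊ - n) -
      Real.sign S * (2 * ((⌊t * (2 * n : ℕ)⌋₊ : ℝ) / (2 * n : ℕ)) - 1)) atTop (𝓝 0) := by
    refine squeeze_zero_norm' ?_ herr
    filter_upwards [hsign, eventually_gt_atTop 0] with n hn hn0
    obtain ⟨j, hj, hfl⟩ := floor_second_phase ht n
    rw [hfl, Nat.add_sub_cancel_left, ← hn]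
    exact abs_signalState_sub_le hσ hn0 (hs1 n) hK hj
  have hmain := hdiff.add (((hfloor.const_mul 2).sub_const 1).const_mul (Real.sign S))
  rw [zero_add, mul_comm] at hmain
  refine hmain.congr fun n => ?_
  simp only [Function.comp_apply]
  ring

lemma eventually_step_nonneg (hσ : 0 < σ) : ∀ᶠ n : ℕ in atTop, ∀ τ ∈ Icc (0 : ℝ) 1,
    0 ≤ 1 + 1 / ((2 * n : ℕ) : ℝ) * (2 * linearCoeff σ τ) := by
  obtain ⟨K, hK⟩ := isCompact_Icc.exists_bound_of_continuousOn (s := Icc (0 : ℝ) 1)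
    (f := fun τ => 2 * linearCoeff σ τ) (by have := continuous_linearCoeff hσ; fun_prop)
  filter_upwards [eventually_ge_atTop ⌈K⌉₊, eventually_gt_atTop 0] with n hn hn0 τ hτ
  have hn0' : (0 : ℝ) < n := by exact_mod_cast hn0
  have hN : (0 : ℝ) < (2 * n : ℕ) := by exact_mod_cast (by omega : 0 < 2 * n)
  have h1 : K ≤ (2 * n : ℕ) := by
    have : K ≤ n := (Nat.le_ceil K).trans (by exact_mod_cast hn)
    push_cast
    linarith
  have h2 := (abs_le.1 (hK τ hτ)).1
  have h3 : 1 + 1 / ((2 * n : ℕ) : ℝ) * (2 * linearCoeff σ τ) =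
      (((2 * n : ℕ) : ℝ) + 2 * linearCoeff σ τ) / (2 * n : ℕ) := by field_simp
  rw [h3]
  exact div_nonneg (by linarith) hN.le

lemma IsOverlapFlow.processHasIteratedLimit_second (hp : p ∈ Icc (0 : ℝ) 1) (hσ : 0 < σ)
    (hκ : 0 < κ) {μ : ℝ → ℝ → ℝ} (hμ : IsOverlapFlow p κ μ) {r : (d : ℕ) → Vec d}
    (hr : ∀ d, ‖r d‖ ^ 2 = (d : ℝ)) {b : (d : ℕ) → ℝ → Vec d → Vec d}
    (hb : ∀ d, IsProbabilityFlowVelocity p σ κ (r d) (b d)) :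
    ProcessHasIteratedLimit (Icc (1 / 2) 1)
      (fun n d t x => ⟪r d, discretizedFlow (b d) (2 * n) t x⟫ / (d : ℝ))
      (fun t g => (2 * t - 1) * selectedMode p κ (μ (1 / 2) g)) (gaussianReal 0 1) := by
  intro m t ht
  have ht1 : ∀ i, t i ∈ Icc (0 : ℝ) 1 := fun i => ⟨by linarith [(ht i).1], (ht i).2⟩
  refine hasIteratedLimitInDistribution_of_overlap hr
    (G := fun n d g i => eulerState (overlapVelocity p σ κ d) (2 * n) g ⌊t i * (2 * n : ℕ)⌋₊ /
      √(d : ℝ))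
    (H := fun n g i => signalState σ n
      (posteriorSign p (κ * eulerState (overlapVelocityLimit p κ) (2 * n) g n))
      (⌊t i * (2 * n : ℕ)⌋₊ - n)) ?_ ?_ ?_ ?_ ?_ ?_
  · intro n d
    refine measurable_pi_lambda _ fun i => Continuous.measurable ?_
    have := (hb d).continuous_discretizedFlow hp hσ (2 * n) (ht1 i)
    fun_prop
  · intro n d hd x
    funext i
    have hsq : √(d : ℝ) * √(d : ℝ) = d := Real.mul_self_sqrt (Nat.cast_nonneg d)
    rw [← (hb d).overlap_discretizedFlow hp hσ hd (hr d) (2 * n) (ht1 i) x, div_div, hsq]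
  · intro n d
    exact measurable_pi_lambda _ fun i =>
      (continuous_eulerState (continuous_overlapVelocity hp d) _ _).measurable.div_const _
  · intro n
    refine measurable_pi_lambda _ fun i => (measurable_signalState σ n _).comp ?_
    exact (continuous_posteriorSign hp).measurable.comp
      ((continuous_eulerState (continuous_overlapVelocityLimit hp) _ _).measurable.const_mul κ)
  · filter_upwards [eventually_gt_atTop 0, eventually_step_nonneg hσ] with n hn hstep
    filter_upwards [ae_posteriorSign_ne_zero hp hκ
      (strictMono_eulerState_overlapVelocityLimit hp hκ (2 * n) n).injective] with g hg
    refine tendsto_pi_nhds.2 fun i => ?_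
    obtain ⟨j, hj, hfl⟩ := floor_second_phase (ht i) n
    rw [hfl, Nat.add_sub_cancel_left]
    exact tendsto_eulerState_overlapVelocity_second hp hσ hn g hstep hg hj
  · filter_upwards [ae_posteriorSign_ne_zero hp hκ (hμ.injective_half hp)] with g hg
    refine tendsto_pi_nhds.2 fun i => ?_
    rw [← sign_posteriorSign hg]
    exact tendsto_signalState hσ (ht i) (((continuous_posteriorSign hp).tendsto _).comp
      ((hμ.tendsto_eulerState_half hp hκ g).const_mul κ)) hg fun n => abs_posteriorSign_le hp _

end distribution

/-! ### The probability of the selected mode -/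

section modeProbability

variable {p κ : ℝ}

/-- The probability `p^κ` that the flow selects the mode `r`. -/
noncomputable def modeProbability (p κ : ℝ) : ℝ :=
  (gaussianMixtureReal p κ).real {y | 0 < posteriorSign p (κ * y)}

lemma measurableSet_posteriorSign_pos (hp : p ∈ Icc (0 : ℝ) 1) (κ : ℝ) :
    MeasurableSet {y | 0 < posteriorSign p (κ * y)} :=
  measurableSet_lt measurable_const
    ((continuous_posteriorSign hp).measurable.comp (measurable_const_mul κ))

lemma modeProbability_mem (hp : p ∈ Icc (0 : ℝ) 1) (κ : ℝ) :
    modeProbability p κ ∈ Icc (0 : ℝ) 1 := by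
  have := isProbabilityMeasure_gaussianMixtureReal hp κ
  exact ⟨measureReal_nonneg, measureReal_le_one⟩

lemma gaussianReal_real_eq_integral_indicator (m : ℝ) {s : Set ℝ} (hs : MeasurableSet s) :
    (gaussianReal m 1).real s = ∫ g, s.indicator (fun _ => (1 : ℝ)) (g + m) ∂gaussianReal 0 1 := by
  have h1 : gaussianReal m 1 = (gaussianReal 0 1).map (· + m) := by
    rw [gaussianReal_map_add_const, zero_add]
  have h2 : AEStronglyMeasurable (s.indicator (1 : ℝ → ℝ)) ((gaussianReal 0 1).map (· + m)) :=
    (measurable_const.indicator hs).aestronglyMeasurable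
  rw [h1, ← integral_indicator_one hs, integral_map (by fun_prop) h2]
  rfl

lemma tendsto_gaussianReal_posteriorSign_pos (hp : p ∈ Icc (0 : ℝ) 1) {e L : ℝ}
    (h : ∀ g : ℝ, ∀ᶠ κ : ℝ in atTop, {y | 0 < posteriorSign p (κ * y)}.indicator
      (fun _ => (1 : ℝ)) (g + e * κ) = L) :
    Tendsto (fun κ => (gaussianReal (e * κ) 1).real {y | 0 < posteriorSign p (κ * y)}) atTop
      (𝓝 L) := by
  have h1 : Tendsto (fun κ : ℝ => ∫ g, {y | 0 < posteriorSign p (κ * y)}.indicator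
      (fun _ => (1 : ℝ)) (g + e * κ) ∂gaussianReal 0 1) atTop
      (𝓝 (∫ _, L ∂gaussianReal 0 1)) := by
    refine tendsto_integral_filter_of_dominated_convergence (fun _ => 1)
      (Eventually.of_forall fun κ => ?_) (Eventually.of_forall fun κ => ae_of_all _ fun g => ?_)
      (integrable_const _) (ae_of_all _ fun g => tendsto_nhds_of_eventually_eq (h g))
    · exact ((measurable_const.indicator (measurableSet_posteriorSign_pos hp κ)).comp
        (measurable_add_const _)).aestronglyMeasurable
    · by_cases hg : g + e * κ ∈ {y | 0 < posteriorSign p (κ * y)}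
      · rw [indicator_of_mem hg, norm_one]
      · rw [indicator_of_notMem hg, norm_zero]
        exact zero_le_one
  simp only [integral_const, probReal_univ, smul_eq_mul, one_mul] at h1
  exact h1.congr fun κ =>
    (gaussianReal_real_eq_integral_indicator _ (measurableSet_posteriorSign_pos hp κ)).symm

lemma tendsto_mode_one (hp : p ∈ Icc (0 : ℝ) 1) (hp0 : 0 < p) :
    Tendsto (fun κ => (gaussianReal κ 1).real {y | 0 < posteriorSign p (κ * y)}) atTop (𝓝 1) := by
  have := tendsto_gaussianReal_posteriorSign_pos hp (e := 1) (L := 1) fun g => ?_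
  · simpa using this
  have h1 : Tendsto (fun κ : ℝ => κ * (g + 1 * κ)) atTop atTop :=
    tendsto_id.atTop_mul_atTop₀
      (tendsto_atTop_add_const_left _ g (tendsto_id.const_mul_atTop one_pos))
  filter_upwards [((tendsto_posteriorSign_atTop hp0).comp h1).eventually (lt_mem_nhds one_pos)]
    with κ hκ
  exact indicator_of_mem (show g + 1 * κ ∈ {y | 0 < posteriorSign p (κ * y)} from hκ) _

lemma tendsto_mode_neg_one (hp : p ∈ Icc (0 : ℝ) 1) (hp1 : p < 1) :
    Tendsto (fun κ => (gaussianReal (-κ) 1).real {y | 0 < posteriorSign p (κ * y)}) atTop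
      (𝓝 0) := by
  have := tendsto_gaussianReal_posteriorSign_pos hp (e := -1) (L := 0) fun g => ?_
  · simpa using this
  have h0 : Tendsto (fun κ : ℝ => g + -1 * κ) atTop atBot :=
    tendsto_atBot_add_const_left _ g (tendsto_id.const_mul_atTop_of_neg (by norm_num))
  have h1 : Tendsto (fun κ : ℝ => κ * (g + -1 * κ)) atTop atBot := tendsto_id.atTop_mul_atBot₀ h0
  filter_upwards [((tendsto_posteriorSign_atBot hp1).comp h1).eventually
    (gt_mem_nhds (show (-1 : ℝ) < 0 by norm_num))] with κ hκ
  exact indicator_of_notMem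
    (show g + -1 * κ ∉ {y | 0 < posteriorSign p (κ * y)} from not_lt.2 (le_of_lt hκ)) _

lemma tendsto_modeProbability (hp : p ∈ Icc (0 : ℝ) 1) :
    Tendsto (modeProbability p) atTop (𝓝 p) := by
  have h1 : Tendsto (fun κ => p * (gaussianReal κ 1).real {y | 0 < posteriorSign p (κ * y)}) atTop
      (𝓝 p) := by
    rcases hp.1.eq_or_lt with h | h
    · simp [← h]
    · simpa using (tendsto_mode_one hp h).const_mul p
  have h2 : Tendsto (fun κ => (1 - p) * (gaussianReal (-κ) 1).real
      {y | 0 < posteriorSign p (κ * y)}) atTop (𝓝 0) := by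
    rcases hp.2.eq_or_lt with h | h
    · simp [h]
    · simpa using (tendsto_mode_neg_one hp h).const_mul (1 - p)
  have h3 := h1.add h2
  rw [add_zero] at h3
  exact h3.congr fun κ => (gaussianMixtureReal_real hp κ _).symm

lemma map_selectedMode (hp : p ∈ Icc (0 : ℝ) 1) (κ : ℝ) :
    (gaussianMixtureReal p κ).map (selectedMode p κ) =
      ENNReal.ofReal (modeProbability p κ) • Measure.dirac 1 +
        ENNReal.ofReal (1 - modeProbability p κ) • Measure.dirac (-1) := by
  have := isProbabilityMeasure_gaussianMixtureReal hp κ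
  have hA := measurableSet_posteriorSign_pos hp κ
  have hmeas : Measurable (selectedMode p κ) := Measurable.ite hA measurable_const measurable_const
  have hc : 1 - modeProbability p κ =
      (gaussianMixtureReal p κ).real {y | 0 < posteriorSign p (κ * y)}ᶜ := by
    rw [probReal_compl_eq_one_sub hA, modeProbability]
  rw [hc, modeProbability, ofReal_measureReal, ofReal_measureReal]
  ext s hs
  rw [Measure.map_apply hmeas hs, ← measure_inter_add_sdiff _ hA, sdiff_eq]
  simp only [Measure.add_apply, Measure.smul_apply, smul_eq_mul, Measure.dirac_apply' _ hs]
  congr 1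
  · by_cases h : (1 : ℝ) ∈ s
    · rw [indicator_of_mem h, Pi.one_apply, mul_one, inter_eq_right.2]
      intro y hy
      rwa [mem_preimage, selectedMode, if_pos (show 0 < posteriorSign p (κ * y) from hy)]
    · have h0 : selectedMode p κ ⁻¹' s ∩ {y | 0 < posteriorSign p (κ * y)} = ∅ := by
        refine eq_empty_of_forall_notMem fun y hy => h ?_
        have h1 := hy.1
        rwa [mem_preimage, selectedMode, if_pos (show 0 < posteriorSign p (κ * y) from hy.2)] at h1
      rw [indicator_of_notMem h, mul_zero, h0, measure_empty]
  · by_cases h : (-1 : ℝ) ∈ s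
    · rw [indicator_of_mem h, Pi.one_apply, mul_one, inter_eq_right.2]
      intro y hy
      rwa [mem_preimage, selectedMode, if_neg (show ¬ 0 < posteriorSign p (κ * y) from hy)]
    · have h0 : selectedMode p κ ⁻¹' s ∩ {y | 0 < posteriorSign p (κ * y)}ᶜ = ∅ := by
        refine eq_empty_of_forall_notMem fun y hy => h ?_
        have h1 := hy.1
        rwa [mem_preimage, selectedMode, if_neg (show ¬ 0 < posteriorSign p (κ * y) from hy.2)] at h1
      rw [indicator_of_notMem h, mul_zero, h0, measure_empty]

end modeProbability

/-! ### The equation of the second phase -/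

lemma hasDerivAt_signal_ode {σ : ℝ} (hσ : 0 < σ) {e : ℝ} (he : e = 1 ∨ e = -1) {t : ℝ}
    (ht : t ∈ Ioo (1 / 2 : ℝ) 1) :
    HasDerivAt (fun u : ℝ => (2 * u - 1) * e)
      ((-(1 - t) + σ ^ 2 * (t - 1 / 2)) / ((1 - t) ^ 2 + σ ^ 2 * (t - 1 / 2) ^ 2) *
          ((2 * t - 1) * e) +
        (1 - t) * Real.sign ((2 * t - 1) * e) / ((1 - t) ^ 2 + σ ^ 2 * (t - 1 / 2) ^ 2)) t := by
  have h1 : HasDerivAt (fun u : ℝ => (2 * u - 1) * e) (2 * e) t := by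
    simpa using (((hasDerivAt_id t).const_mul 2).sub_const 1).mul_const e
  have hsign : Real.sign ((2 * t - 1) * e) = e := by
    rcases he with rfl | rfl
    · exact Real.sign_of_pos (by linarith [ht.1])
    · exact Real.sign_of_neg (by linarith [ht.1])
  have hD : 0 < (1 - t) ^ 2 + σ ^ 2 * (t - 1 / 2) ^ 2 := by
    have : 0 < 1 - t := by linarith [ht.2]
    positivity
  refine h1.congr_deriv ?_
  rw [hsign, div_mul_eq_mul_div, ← add_div, eq_div_iff hD.ne']
  ring

theorem theorem1 (p : ℝ) (hp : p ∈ Set.Icc (0 : ℝ) 1) :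
    ∃ q : ℝ → ℝ, (∀ κ, q κ ∈ Set.Icc (0 : ℝ) 1) ∧ Tendsto q atTop (𝓝 p) ∧
    ∀ (σ κ : ℝ), 0 < σ → 0 < κ →
    ∀ (r : (d : ℕ) → Vec d), (∀ d, ‖r d‖ ^ 2 = (d : ℝ)) →
    ∀ (b : (d : ℕ) → ℝ → Vec d → Vec d),
      (∀ d, IsProbabilityFlowVelocity p σ κ (r d) (b d)) →
    -- the component orthogonal to `r`
    (∃ s : ℕ → ℕ → ℝ → ℝ, (∀ N d t, 0 ≤ s N d t) ∧
      (∀ N d : ℕ, 1 ≤ N → 1 ≤ d → ∀ t ∈ Set.Icc (0 : ℝ) 1,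
        (stdGaussian (Vec d)).map (fun x => discretizedFlow (b d) N t x -
            (⟪r d, discretizedFlow (b d) N t x⟫ / (d : ℝ)) • r d) =
          (stdGaussian ((ℝ ∙ r d)ᗮ : Submodule ℝ (Vec d))).map
            (fun w : ((ℝ ∙ r d)ᗮ : Submodule ℝ (Vec d)) => s N d t • (w : Vec d))) ∧
      (∀ t ∈ Set.Icc (0 : ℝ) (1 / 2), HasIteratedLimit (fun N d => s N d t) 1) ∧
      (∀ t ∈ Set.Icc (1 / 2 : ℝ) 1, HasIteratedLimit (fun N d => s N d t)
        √((2 - 2 * t) ^ 2 + (2 * t - 1) ^ 2 * σ ^ 2))) ∧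
    -- first phase
    (∃ (Ω : Type) (_ : MeasurableSpace Ω) (P : Measure Ω) (_ : IsProbabilityMeasure P)
        (μ : ℝ → Ω → ℝ),
      ProcessHasIteratedLimit (Set.Icc 0 (1 / 2))
        (fun N d t x => ⟪r d, discretizedFlow (b d) N t x⟫ / √(d : ℝ)) μ P ∧
      P.map (μ 0) = gaussianReal 0 1 ∧
      (∀ h : ℝ, p = Real.exp h / (Real.exp h + Real.exp (-h)) →
        ∀ᵐ ω ∂P, ∀ t ∈ Set.Icc (0 : ℝ) (1 / 2),
          HasDerivWithinAt (fun u => μ u ω)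
            (2 * κ * Real.tanh (h + 2 * κ * t * μ t ω)) (Set.Icc 0 (1 / 2)) t) ∧
      P.map (μ (1 / 2)) = gaussianMixtureReal p κ) ∧
    -- second phase
    (∃ (Ω : Type) (_ : MeasurableSpace Ω) (P : Measure Ω) (_ : IsProbabilityMeasure P)
        (M : ℝ → Ω → ℝ),
      ProcessHasIteratedLimit (Set.Icc (1 / 2) 1)
        (fun n d t x => ⟪r d, discretizedFlow (b d) (2 * n) t x⟫ / (d : ℝ)) M P ∧
      (∀ᵐ ω ∂P, ∀ t ∈ Set.Ioo (1 / 2 : ℝ) 1,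
        HasDerivAt (fun u => M u ω)
          ((-(1 - t) + σ ^ 2 * (t - 1 / 2)) / ((1 - t) ^ 2 + σ ^ 2 * (t - 1 / 2) ^ 2) * M t ω +
            (1 - t) * Real.sign (M t ω) / ((1 - t) ^ 2 + σ ^ 2 * (t - 1 / 2) ^ 2)) t) ∧
      P.map (M 1) = ENNReal.ofReal (q κ) • Measure.dirac 1 +
        ENNReal.ofReal (1 - q κ) • Measure.dirac (-1)) := by
  refine ⟨modeProbability p, modeProbability_mem hp, tendsto_modeProbability hp,
    fun σ κ hσ hκ r hr b hb => ?_⟩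
  obtain ⟨μ, hμ⟩ := exists_isOverlapFlow hp hκ
  refine ⟨⟨fun N d t => orthogonalScale σ κ N d t, fun N d t => abs_nonneg _,
    fun N d _ hd t ht => ?_, fun t ht => hasIteratedLimit_orthogonalScale_first hσ ht,
    fun t ht => hasIteratedLimit_orthogonalScale_second hσ ht⟩,
    ⟨ℝ, inferInstance, gaussianReal 0 1, inferInstance, μ,
      hμ.processHasIteratedLimit hp hσ hκ hr hb, ?_, fun h hh => ?_, hμ.map_half hp hκ⟩,
    ⟨ℝ, inferInstance, gaussianReal 0 1, inferInstance,
      fun t g => (2 * t - 1) * selectedMode p κ (μ (1 / 2) g),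
      hμ.processHasIteratedLimit_second hp hσ hκ hr hb, ?_, ?_⟩⟩
  · simp only [(hb d).discretizedFlow_eq hp hσ N ht,
      eulerState_flowVelocity_orthogonal hd (hr d)]
    exact map_orthogonal_component (hr d) _
  · rw [funext hμ.start]
    exact Measure.map_id
  · refine ae_of_all _ fun g t ht => ?_
    have h1 := hμ.hasDeriv g t ht
    rwa [overlapVelocityLimit, posteriorSign_eq_tanh hh] at h1
  · exact ae_of_all _ fun g t ht => hasDerivAt_signal_ode hσ (selectedMode_eq_or p κ _) ht
  · have hmeas : Measurable (selectedMode p κ) :=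
      Measurable.ite (measurableSet_posteriorSign_pos hp κ) measurable_const measurable_const
    rw [← map_selectedMode hp κ, ← hμ.map_half hp hκ,
      Measure.map_map hmeas (hμ.measurable hp hκ (right_mem_Icc.2 (by norm_num)))]
    congr 1
    funext g
    simp only [Function.comp_apply]
    ring
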